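/- Let $p,q$ be coprime positive integers. For $n\ge 2$ and $\mathbb K\in\{\mathbb R,\mathbb C\}$ consider the $p:-q$ resonant saddles $$\dot x = px+P(x,y),\qquad \dot y=-qy+Q(x,y),$$ where $P,Q\in\mathbb K[x,y]$ are homogeneous of degree $n$. For such a system there is a formal power series $H=x^qy^p+\text{(terms of total degree greater than } p+q)$ whose derivative along the system has the form $$\dot H=\sum_{k\ge 1}L_k\,(x^qy^p)^{k+1},\qquad L_k\in\mathbb K;$$ $L_k$ is called the $k$-th saddle value. If not all the $L_k$ vanish, the saddle order of the system is the least $k\ge1$ with $L_k\ne 0$; it does not depend on the choice of $H$. Let $M_h(p,q,n)$ be the maximal possible (that is, the supremum of the) saddle order of the systems above with at least one nonzero saddle value. Theorem. For all coprime positive integers $p,q$ there is an $N$ such that for all $n\ge N$, both for $\mathbb K=\mathbb R$ and for $\mathbb K=\mathbb C$, $$M_h(p,q,n)\ \ge\ \frac{n^2-1}{d},\qquad d=\gcd(n-1,\,p+q).$$ -/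

import Mathlib

noncomputable section

namespace ResonantSaddle

open MvPowerSeries

variable {𝕜 : Type*} [Field 𝕜]

/-- The exponent of the monomial `x ^ q * y ^ p`, where `x` is the variable of index `0` and `y` is
the variable of index `1`. -/
def resExp (p q : ℕ) : Fin 2 →₀ ℕ :=
  Finsupp.single 0 q + Finsupp.single 1 p

/-- The derivative `Ḣ` of the formal power series `H` along the system
`ẋ = p x + P(x, y)`, `ẏ = - q y + Q(x, y)`. -/
def lieDeriv (p q : ℕ) (P Q : MvPolynomial (Fin 2) 𝕜) (H : MvPowerSeries (Fin 2) 𝕜) :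
    MvPowerSeries (Fin 2) 𝕜 :=
  ((p : MvPowerSeries (Fin 2) 𝕜) * X 0 + (P : MvPowerSeries (Fin 2) 𝕜)) * pderiv 𝕜 0 H
    + (-(q : MvPowerSeries (Fin 2) 𝕜) * X 1 + (Q : MvPowerSeries (Fin 2) 𝕜)) * pderiv 𝕜 1 H

/-- `H = x ^ q * y ^ p + h.o.t.`: every term of `H` of total degree at most `p + q` is a term of
`x ^ q * y ^ p`. -/
def HasLeadingTerm (p q : ℕ) (H : MvPowerSeries (Fin 2) 𝕜) : Prop :=
  ∀ m : Fin 2 →₀ ℕ, m.degree ≤ p + q →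
    coeff m H = coeff m (monomial (resExp p q) (1 : 𝕜))

/-- `H = x ^ q * y ^ p + h.o.t.` and `Ḣ = ∑_{k ≥ 1} L k * (x ^ q * y ^ p) ^ (k + 1)`, so that
`L 1, L 2, …` are saddle values of the system `ẋ = p x + P`, `ẏ = - q y + Q`. The value `L 0` plays
no role. -/
structure IsSaddleExpansion (p q : ℕ) (P Q : MvPolynomial (Fin 2) 𝕜)
    (H : MvPowerSeries (Fin 2) 𝕜) (L : ℕ → 𝕜) : Prop where
  leading : HasLeadingTerm p q H
  coeff_resonant : ∀ k : ℕ, 1 ≤ k → coeff ((k + 1) • resExp p q) (lieDeriv p q P Q H) = L k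
  coeff_other : ∀ m : Fin 2 →₀ ℕ, (∀ k : ℕ, 1 ≤ k → m ≠ (k + 1) • resExp p q) →
    coeff m (lieDeriv p q P Q H) = 0

/-- The system `ẋ = p x + P`, `ẏ = - q y + Q` has saddle order `k`: the first nonzero saddle value
is the `k`-th one. (The saddle values depend on the choice of `H`, the order does not.) -/
def HasSaddleOrder (p q : ℕ) (P Q : MvPolynomial (Fin 2) 𝕜) (k : ℕ) : Prop :=
  ∃ (H : MvPowerSeries (Fin 2) 𝕜) (L : ℕ → 𝕜), IsSaddleExpansion p q P Q H L ∧
    1 ≤ k ∧ (∀ j : ℕ, 1 ≤ j → j < k → L j = 0) ∧ L k ≠ 0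

variable (𝕜) in
/-- All (finite) saddle orders of systems `ẋ = p x + P`, `ẏ = - q y + Q` with `P`, `Q` homogeneous
of degree `n` over `𝕜`. -/
def homogeneousSaddleOrders (p q n : ℕ) : Set ℕ :=
  {k | ∃ P Q : MvPolynomial (Fin 2) 𝕜, P.IsHomogeneous n ∧ Q.IsHomogeneous n ∧
    HasSaddleOrder p q P Q k}

variable (𝕜) in
/-- The maximal possible saddle order `M_h(p, q, n)` of systems with homogeneous nonlinearity of
degree `n`, as a supremum of natural numbers in `ℕ∞`: a bound `N ≤ M_h` with `N ≥ 1` means that some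
non-integrable system has a (finite) saddle order at least `N`. -/
def maxSaddleOrder (p q n : ℕ) : ℕ∞ :=
  ⨆ k ∈ homogeneousSaddleOrders 𝕜 p q n, (k : ℕ∞)

end ResonantSaddle

end

/-!
The idea is to perturb an integrable system to first order.

Write `a = n - 1`, `d = gcd (a, p + q)`, `e = a / d` and `s = (p + q) / d`. For a series
`H` whose degrees are all congruent to `p + q` modulo `a`, the value `L k` can be nonzero only for
`k = i e`, so the claim is that some system has `L (i e) = 0` for
`1 ≤ i ≤ n` and `L ((n + 1) e) ≠ 0`: indeed `(n + 1) e = (n ^ 2 - 1) / d`.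

*The unperturbed system.* For `g` homogeneous of degree `a` there is a homogeneous polynomial `φ`
(`cofactor`) such that `ẋ = x (p + φ)`, `ẏ = y (-q + φ)` is linearized by the coordinates
`X = x (1 + g) ^ (-1 / a)`, `Y = y (1 + g) ^ (-1 / a)`. It has the first integral `X ^ q Y ^ p`
(`firstIntegral`), and the coefficient of `(X ^ q Y ^ p) ^ (k + 1)` in a series, taken in the
variables `X`, `Y`, is a functional `linearizedCoeff` that vanishes on all derivatives along this
system (`linearizedCoeff_lieDeriv`).

*The perturbation.* The terms `v_l x ^ (n - l) y ^ l`, `0 ≤ l ≤ n`, are added to `ẋ` for `l ≥ 1`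
and to `ẏ` for `l = 0`. A series `H` with prescribed resonant part and only resonant terms in
`Ḣ` exists by Picard iteration (`normalForm`), and its coefficients are smooth functions of `v`.
Applying the functionals with `k = i e`, `1 ≤ i ≤ n + 1`, to `Ḣ` gives a map `v ↦ τ(v) v`, where
the square matrix `τ(0)` is the matrix of first variations of the first integral
(`linearizedCoeff_variation`). If `τ(0)` is invertible, the inverse function theorem yields a `v`
for which only the last of these values is nonzero, and this says that the first nonzero saddle
value has index `(n + 1) e`.

*Invertibility.* For `g = x ^ c (x + y) ^ N` the entries of `τ(0)` are, up to a weight of the column,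
binomial coefficients. Up to a factor that depends on the row only, the entry in row `i` is the
value at `i` of a product of falling factorials in `E x + 1` and `B x + c + 1`, where `E = p e` and
`E + B = N s`. These polynomials have degree `n + 1` and vanish at `0`, so a relation between the
columns is a polynomial with `n + 2` zeros and holds identically (`matEntry_injective`). If `E` is
coprime to `N`, evaluation at `-1 / E, 1 / E, …, n / E` is triangular
(`fallPoly_linearIndependent`). A suitable `c` is a divisor of `p` (`exists_dvd_coprime_sub`). At
most one weight vanishes, and only if `p + q` divides `a`; the first row then takes care of that
column (`linearizedCoeff_variation_resonant`).
-/

noncomputable section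

namespace ResonantSaddle

/-! ### Products of falling factorials and a matrix of binomial coefficients -/

open Polynomial in
/-- The falling factorials `(E x + 1)_κ (B x + c + 1)_κ'` as a polynomial in `x`. -/
def fallPoly (K : Type*) [Field K] (E B c κ κ' : ℕ) : K[X] :=
  (descPochhammer K κ).comp (C (E : K) * X + 1) *
    (descPochhammer K κ').comp (C (B : K) * X + C ((c : K) + 1))

section Matrix

variable {K : Type*} [Field K]

lemma eval_fallPoly (E B c κ κ' : ℕ) (x : K) :
    (fallPoly K E B c κ κ').eval x =
      (descPochhammer K κ).eval (E * x + 1) * (descPochhammer K κ').eval (B * x + (c + 1)) := by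
  simp [fallPoly]

lemma eval_fallPoly_natCast (E B c κ κ' i : ℕ) :
    (fallPoly K E B c κ κ').eval (i : K) =
      (((i * E + 1).descFactorial κ * (i * B + c + 1).descFactorial κ' : ℕ) : K) := by
  rw [eval_fallPoly]
  have h1 : (E : K) * i + 1 = ((i * E + 1 : ℕ) : K) := by push_cast; ring
  have h2 : (B : K) * i + (c + 1) = ((i * B + c + 1 : ℕ) : K) := by push_cast; ring
  rw [h1, h2, descPochhammer_eval_eq_descFactorial, descPochhammer_eval_eq_descFactorial]
  push_cast; ring

lemma natDegree_fallPoly_le (E B c κ κ' : ℕ) :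
    (fallPoly K E B c κ κ').natDegree ≤ κ + κ' := by
  unfold fallPoly
  refine Polynomial.natDegree_mul_le.trans (add_le_add ?_ ?_)
  all_goals
    refine Polynomial.natDegree_comp_le.trans ?_
    rw [descPochhammer_natDegree]
    refine (Nat.mul_le_mul_left _ (?_ : _ ≤ 1)).trans (mul_one _).le
    compute_degree

/-- Up to factors that depend on the row only, a binomial coefficient is a product of two falling
factorials. -/
lemma choose_mul_factorial_mul_factorial {M a b κ κ' : ℕ} (h : a + b = M + (κ + κ')) :
    (if κ ≤ a then M.choose (a - κ) else 0) * (a.factorial * b.factorial) =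
      M.factorial * (a.descFactorial κ * b.descFactorial κ') := by
  split_ifs with hκ
  · by_cases hκ' : κ' ≤ b
    · have h1 := Nat.factorial_mul_descFactorial hκ
      have h2 := Nat.factorial_mul_descFactorial hκ'
      have h3 := Nat.choose_mul_factorial_mul_factorial (n := M) (k := a - κ) (by omega)
      rw [show M - (a - κ) = b - κ' by omega] at h3
      rw [← h1, ← h2, ← h3]; ring
    · rw [Nat.choose_eq_zero_of_lt (by omega),
        Nat.descFactorial_eq_zero_iff_lt.mpr (not_le.mp hκ')]
      simp
  · rw [Nat.descFactorial_eq_zero_iff_lt.mpr (not_le.mp hκ)]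
    simp

/-- The coefficient of `t ^ (i E - l)` in `(1 + t) ^ M` for `l ≥ 1`, and that of `t ^ (i E + 1)` for
`l = 0`: the entry in row `i`, column `l` of the matrix of first variations, without the weight of
the column. -/
def matEntry (E M i l : ℕ) : ℕ :=
  if l = 0 then M.choose (i * E + 1) else if l ≤ i * E then M.choose (i * E - l) else 0

/-- The length of the first falling factorial in column `l`. The value `1` is left out: the products
of all lengths `0, …, n + 1` have a common zero at `0` and hence are linearly dependent. -/
def colIdx (l : ℕ) : ℕ := if l = 0 then 0 else l + 1

lemma matEntry_mul_factorial {E B c n M i l : ℕ} (hl : l ≤ n)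
    (hM : i * E + 1 + (i * B + c + 1) = M + (n + 1)) :
    matEntry E M i l * ((i * E + 1).factorial * (i * B + c + 1).factorial) =
      M.factorial * ((i * E + 1).descFactorial (colIdx l) *
        (i * B + c + 1).descFactorial (n + 1 - colIdx l)) := by
  have hc : colIdx l ≤ n + 1 := by unfold colIdx; split_ifs <;> omega
  rw [← choose_mul_factorial_mul_factorial (M := M) (by omega)]
  congr 1
  unfold matEntry colIdx
  split_ifs <;> first | omega | rfl | (congr 1; omega)

lemma descPochhammer_eval_ne_zero {k : ℕ} {r : K} (h : ∀ j : ℕ, j < k → r ≠ j) :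
    (descPochhammer K k).eval r ≠ 0 := by
  rw [descPochhammer_eval_eq_prod_range, Finset.prod_ne_zero_iff]
  intro j hj
  exact sub_ne_zero.mpr (h j (Finset.mem_range.mp hj))

variable [CharZero K]

/-- The polynomials `fallPoly` of the columns are linearly independent, by triangularity of their
values at `-1 / E, 1 / E, 2 / E, …, n / E`. -/
lemma fallPoly_linearIndependent {E B c n N : ℕ} (hE : 2 ≤ E) (hEB : Nat.Coprime E B)
    (hN : N ≤ E + B) (hn : n = N + c + 1) {μ : Fin (n + 1) → K}
    (h : ∑ l : Fin (n + 1), Polynomial.C (μ l) *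
      fallPoly K E B c (colIdx l) (n + 1 - colIdx l) = 0) : μ = 0 := by
  have hE0 : (E : K) ≠ 0 := by exact_mod_cast (by omega : E ≠ 0)
  have hx : ∀ x : K, ∑ l : Fin (n + 1), μ l *
      (fallPoly K E B c (colIdx l) (n + 1 - colIdx l)).eval x = 0 := fun x => by
    have := congrArg (Polynomial.eval x) h
    simpa [Polynomial.eval_finsetSum] using this
  have h0 : μ 0 = 0 := by
    -- at `-1 / E` all columns but the first vanish
    have h1 := hx (-1 / E)
    rw [Finset.sum_eq_single (0 : Fin (n + 1))] at h1
    · refine (mul_eq_zero.mp h1).resolve_right ?_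
      rw [eval_fallPoly]
      refine mul_ne_zero (by simp [colIdx]) (descPochhammer_eval_ne_zero fun j _ hj => ?_)
      have h2 : ((c : ℤ) + 1 - j) * E = B := by
        have : ((c : K) + 1 - j) * E = B := by rw [← hj]; field_simp; ring
        exact_mod_cast this
      have h3 : E ∣ B := by
        have : (E : ℤ) ∣ B := ⟨(c : ℤ) + 1 - j, by rw [← h2]; ring⟩
        exact_mod_cast this
      have := Nat.eq_one_of_dvd_coprimes hEB dvd_rfl h3
      omega
    · intro l _ hl
      have : (l : ℕ) ≠ 0 := fun h => hl (Fin.ext h)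
      rw [eval_fallPoly, mul_div_cancel₀ _ hE0, colIdx, if_neg this]
      rw [neg_add_cancel, descPochhammer_ne_zero_eval_zero _ (by omega)]
      simp
    · simp
  have key : ∀ l : ℕ, ∀ hl : l < n + 1, μ ⟨l, hl⟩ = 0 := by
    intro l
    induction l using Nat.strong_induction_on with
    | _ l ih =>
      intro hl
      rcases Nat.eq_zero_or_pos l with rfl | hpos
      · exact h0
      -- at `l / E` all columns after column `l` vanish
      have h1 := hx (l / E)
      rw [Finset.sum_eq_single (⟨l, hl⟩ : Fin (n + 1))] at h1
      · refine (mul_eq_zero.mp h1).resolve_right ?_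
        rw [eval_fallPoly]
        have hcol : colIdx l = l + 1 := by simp [colIdx, hpos.ne']
        simp only [hcol, mul_div_cancel₀ _ hE0]
        refine mul_ne_zero (descPochhammer_eval_ne_zero fun j hj h => ?_)
          (descPochhammer_eval_ne_zero fun j hj h => ?_)
        · have : l + 1 = j := by exact_mod_cast h
          omega
        · have h2 : (j : ℤ) * E = B * l + (c + 1) * E := by
            have : (j : K) * E = B * l + (c + 1) * E := by rw [← h]; field_simp
            exact_mod_cast this
          have h3 : E ∣ l := by
            have h4 : (E : ℤ) ∣ (B * l : ℕ) := ⟨j - (c + 1), by push_cast; linarith⟩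
            exact hEB.dvd_of_dvd_mul_left (by exact_mod_cast h4)
          obtain ⟨t, rfl⟩ := h3
          have ht : 1 ≤ t := Nat.pos_of_mul_pos_left hpos
          have h5 : (j : ℤ) = B * t + (c + 1) := by
            have : ((E : ℕ) : ℤ) ≠ 0 := by exact_mod_cast (by omega : E ≠ 0)
            apply mul_right_cancel₀ this
            push_cast at h2
            linarith
          have h6 : j = B * t + (c + 1) := by exact_mod_cast h5
          -- `l = E t` and `j = B t + c + 1 < n - l` would give `(E + B) t < N`
          have h7 : N * 1 ≤ (E + B) * t := Nat.mul_le_mul hN ht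
          rw [add_mul] at h7
          omega
      · intro l' _ hl'
        rcases lt_or_ge (l' : ℕ) l with h | h
        · rw [ih l' h l'.2, zero_mul]
        · have h' : l < (l' : ℕ) := lt_of_le_of_ne h fun h => hl' (Fin.ext h.symm)
          have hcol : colIdx (l' : ℕ) = l' + 1 := if_neg (by omega)
          rw [eval_fallPoly, mul_div_cancel₀ _ hE0, hcol,
            show (l : K) + 1 = ((l + 1 : ℕ) : K) by push_cast; ring,
            descPochhammer_eval_eq_descFactorial,
            Nat.descFactorial_eq_zero_iff_lt.mpr (by omega)]
          simp
      · simp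
  funext l
  exact key l l.2

/-- The square matrix of binomial coefficients is injective: a vector in its kernel gives a
polynomial of degree at most `n + 1` that vanishes at `0, 1, …, n + 1`. -/
lemma matEntry_injective {E B c n N : ℕ} (hE : 2 ≤ E) (hEB : Nat.Coprime E B)
    (hN : N ≤ E + B) (hN1 : 1 ≤ N) (hn : n = N + c + 1) {M : ℕ → ℕ}
    (hM : ∀ i, 1 ≤ i → M i + N = i * (E + B)) {μ : Fin (n + 1) → K}
    (h : ∀ i, 1 ≤ i → i ≤ n + 1 → ∑ l : Fin (n + 1), μ l * (matEntry E (M i) i l : K) = 0) :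
    μ = 0 := by
  refine fallPoly_linearIndependent hE hEB hN hn ?_
  refine Polynomial.eq_zero_of_natDegree_lt_card_of_eval_eq_zero (ι := Fin (n + 2)) _
    (f := fun i => ((i : ℕ) : K)) (fun i j hij => Fin.ext (Nat.cast_injective hij)) (fun i => ?_) ?_
  · rw [Polynomial.eval_finsetSum]
    simp only [Polynomial.eval_mul, Polynomial.eval_C, eval_fallPoly_natCast]
    rcases Nat.eq_zero_or_pos (i : ℕ) with hi | hi
    · refine Finset.sum_eq_zero fun l _ => ?_
      rw [hi]
      rcases Nat.eq_zero_or_pos (l : ℕ) with hl | hl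
      · rw [Nat.descFactorial_eq_zero_iff_lt.mpr
          (by simp only [hl, colIdx, if_true]; omega : 0 * B + c + 1 < _)]
        simp
      · rw [Nat.descFactorial_eq_zero_iff_lt.mpr
          (by rw [colIdx, if_neg hl.ne']; omega : 0 * E + 1 < colIdx l)]
        simp
    · have h1 := h i hi (by omega)
      have h2 := hM i hi
      have hf : ((M i).factorial : K) ≠ 0 := by exact_mod_cast (Nat.factorial_pos _).ne'
      apply mul_left_cancel₀ hf
      rw [mul_zero, ← zero_mul (((((i : ℕ) * E + 1).factorial * ((i : ℕ) * B + c + 1).factorial : ℕ)) : K),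
        ← h1, Finset.sum_mul, Finset.mul_sum]
      refine Finset.sum_congr rfl fun l _ => ?_
      have h3 := matEntry_mul_factorial (E := E) (B := B) (c := c) (n := n) (M := M i) (i := i)
        (l := l) (by omega) (by rw [mul_add] at h2; omega)
      have h4 := congrArg (Nat.cast (R := K)) h3
      push_cast at h4 ⊢
      linear_combination -(μ l) * h4
  · refine lt_of_le_of_lt (Polynomial.natDegree_sum_le_of_forall_le _ _ (n := n + 1) fun l _ => ?_)
      (by simp)
    refine (Polynomial.natDegree_C_mul_le _ _).trans ((natDegree_fallPoly_le _ _ _ _ _).trans ?_)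
    have hc : colIdx l ≤ n + 1 := by unfold colIdx; split_ifs <;> omega
    omega

end Matrix

/-! ### Choice of the numerical parameters -/

/-- For `1 ≤ p ≤ a`, some divisor `c` of `p` makes `a - c` coprime to `p * a`: the product
of the prime divisors of `p` that do not divide `a`. -/
lemma exists_dvd_coprime_sub {p a : ℕ} (hp : 1 ≤ p) (ha : p ≤ a) :
    ∃ c, c ∣ p ∧ Nat.Coprime (p * a) (a - c) := by
  set S := p.primeFactors.filter (fun r => ¬ r ∣ a) with hS
  have hdvd : ∏ r ∈ S, r ∣ p :=
    (Finset.prod_dvd_prod_of_subset _ _ _ (Finset.filter_subset _ _)).trans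
      (Nat.prod_primeFactors_dvd p)
  refine ⟨∏ r ∈ S, r, hdvd, ?_⟩
  have hle : ∏ r ∈ S, r ≤ a := (Nat.le_of_dvd hp hdvd).trans ha
  refine Nat.Coprime.symm (Nat.coprime_of_dvd fun r hr h1 h2 => ?_)
  have key : r ∣ a ↔ r ∣ ∏ r ∈ S, r := by
    have : a = (a - ∏ r ∈ S, r) + ∏ r ∈ S, r := by omega
    constructor
    · intro h
      rw [this] at h
      exact (Nat.dvd_add_right h1).mp h
    · intro h
      rw [this]
      exact dvd_add h1 h
  by_cases hra : r ∣ a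
  · obtain ⟨l, hl, hrl⟩ := (hr.prime.dvd_finsetProd_iff _).mp (key.mp hra)
    rw [hS, Finset.mem_filter] at hl
    have : r = l := (Nat.prime_dvd_prime_iff_eq hr (Nat.prime_of_mem_primeFactors hl.1)).mp hrl
    exact hl.2 (this ▸ hra)
  · have hrp : r ∣ p := ((hr.dvd_mul).mp h2).resolve_right hra
    refine hra (key.mpr (Finset.dvd_prod_of_mem _ ?_))
    rw [hS, Finset.mem_filter]
    exact ⟨Nat.mem_primeFactors.mpr ⟨hr, hrp, by omega⟩, hra⟩

/-- The numerical data of the construction, for `n - 1 = a` large. -/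
lemma exists_parameters {p q a : ℕ} (hp : 1 ≤ p) (hq : 1 ≤ q) (hpq : Nat.Coprime p q)
    (ha : (p + 1) * (p + q) + 1 ≤ a) :
    ∃ c N e s B : ℕ, N + c = a ∧ 1 ≤ N ∧ 1 ≤ e ∧ 1 ≤ s ∧ 2 ≤ p * e ∧ p * e + B = N * s ∧
      Nat.Coprime (p * e) B ∧ N ≤ p * e + B ∧ e * (p + q) = s * a ∧ Nat.Coprime e s ∧
      a = Nat.gcd a (p + q) * e := by
  have hpa : p ≤ a := by nlinarith
  obtain ⟨c, hc, hcop⟩ := exists_dvd_coprime_sub hp hpa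
  have hcp : c ≤ p := Nat.le_of_dvd hp hc
  set d := Nat.gcd a (p + q) with hd
  have hdpos : 0 < d := Nat.gcd_pos_of_pos_right _ (by omega)
  obtain ⟨e, he⟩ : d ∣ a := Nat.gcd_dvd_left _ _
  obtain ⟨s, hs⟩ : d ∣ p + q := Nat.gcd_dvd_right _ _
  have hes : Nat.Coprime e s := by
    have h := Nat.coprime_div_gcd_div_gcd (m := a) (n := p + q) hdpos
    rw [← hd, Nat.div_eq_of_eq_mul_right hdpos he, Nat.div_eq_of_eq_mul_right hdpos hs] at h
    exact h
  have hs1 : 1 ≤ s := Nat.pos_of_ne_zero (by rintro rfl; omega)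
  have he1 : 1 ≤ e := Nat.pos_of_ne_zero (by rintro rfl; omega)
  have hds : d ≤ p + q := by rw [hs]; exact Nat.le_mul_of_pos_right _ hs1
  have he2 : 2 ≤ e := by
    by_contra h
    have : e = 1 := by omega
    subst this
    nlinarith
  have hca : c < a := by nlinarith
  have hrel : e * (p + q) = s * a := by rw [hs, he]; ring
  have hps : Nat.Coprime p s := by
    have : Nat.Coprime p (p + q) := by simpa using hpq
    exact this.coprime_dvd_right ⟨d, by rw [hs]; ring⟩
  have hpeN : Nat.Coprime (p * e) (a - c) :=
    hcop.coprime_dvd_left (Nat.mul_dvd_mul_left p ⟨d, by rw [mul_comm]; exact he⟩)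
  have hcopE : Nat.Coprime (p * e) ((a - c) * s) :=
    Nat.Coprime.mul_right hpeN (Nat.Coprime.mul_left hps hes)
  have hlt : p * e ≤ (a - c) * s := by
    have h1 : d * (p * e) ≤ d * ((a - c) * s) := by
      have h2 : d * (p * e) = p * a := by rw [mul_left_comm, ← he]
      have h3 : d * ((a - c) * s) = (a - c) * (p + q) := by rw [hs]; ring
      rw [h2, h3]
      zify [hca.le]
      have : (c : ℤ) * (p + q) ≤ p * (p + q) := by
        exact_mod_cast Nat.mul_le_mul_right _ hcp
      have h4 : ((p : ℤ) + 1) * (p + q) + 1 ≤ a := by exact_mod_cast ha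
      have h5 : (1 : ℤ) ≤ q := by exact_mod_cast hq
      nlinarith
    exact Nat.le_of_mul_le_mul_left h1 hdpos
  refine ⟨c, a - c, e, s, (a - c) * s - p * e, by omega, by omega, he1, hs1, by nlinarith,
    by omega, ?_, ?_, hrel, hes, he⟩
  · have : (a - c) * s = ((a - c) * s - p * e) + p * e := by omega
    rw [this] at hcopE
    simpa using hcopE
  · rw [Nat.add_sub_cancel' hlt]
    exact Nat.le_mul_of_pos_right _ hs1

/-! ### Formal normal forms -/

open MvPowerSeries

section NormalForm

variable {𝕜 : Type*} [Field 𝕜]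

/-- The derivation `f ∂/∂x + g ∂/∂y` of the ring of formal power series. -/
def vectorField (f g : MvPowerSeries (Fin 2) 𝕜) :
    Derivation 𝕜 (MvPowerSeries (Fin 2) 𝕜) (MvPowerSeries (Fin 2) 𝕜) :=
  f • pderiv 𝕜 0 + g • pderiv 𝕜 1

lemma vectorField_apply (f g F : MvPowerSeries (Fin 2) 𝕜) :
    vectorField f g F = f * pderiv 𝕜 0 F + g * pderiv 𝕜 1 F := rfl

lemma coeff_X_mul_pderiv (i : Fin 2) (m : Fin 2 →₀ ℕ) (F : MvPowerSeries (Fin 2) 𝕜) :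
    coeff m (X i * pderiv 𝕜 i F) = m i * coeff m F := by
  classical
  rw [X, coeff_monomial_mul]
  split_ifs with h
  · rw [coeff_pderiv, tsub_add_cancel_of_le h]
    have : 1 ≤ m i := by simpa using h i
    simp only [Finsupp.coe_tsub, Pi.sub_apply, Finsupp.single_eq_same]
    rw [Nat.cast_sub this]
    push_cast; ring
  · have : m i = 0 := by
      by_contra h'
      exact h (Finsupp.single_le_iff.mpr (Nat.one_le_iff_ne_zero.mpr h'))
    simp [this]

lemma lieDeriv_eq (p q : ℕ) (P Q : MvPolynomial (Fin 2) 𝕜) (F : MvPowerSeries (Fin 2) 𝕜) :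
    lieDeriv p q P Q F = (p : MvPowerSeries (Fin 2) 𝕜) * (X 0 * pderiv 𝕜 0 F)
      - (q : MvPowerSeries (Fin 2) 𝕜) * (X 1 * pderiv 𝕜 1 F)
      + vectorField (P : MvPowerSeries (Fin 2) 𝕜) Q F := by
  rw [lieDeriv, vectorField_apply]; ring

lemma coeff_natCast_mul (a : ℕ) (m : Fin 2 →₀ ℕ) (F : MvPowerSeries (Fin 2) 𝕜) :
    coeff m ((a : MvPowerSeries (Fin 2) 𝕜) * F) = a * coeff m F := by
  rw [← map_natCast (MvPowerSeries.C (σ := Fin 2) (R := 𝕜)), coeff_C_mul]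

lemma coeff_lieDeriv (p q : ℕ) (P Q : MvPolynomial (Fin 2) 𝕜) (F : MvPowerSeries (Fin 2) 𝕜)
    (m : Fin 2 →₀ ℕ) :
    coeff m (lieDeriv p q P Q F) = ((p : 𝕜) * m 0 - q * m 1) * coeff m F
      + coeff m (vectorField (P : MvPowerSeries (Fin 2) 𝕜) Q F) := by
  rw [lieDeriv_eq, map_add, map_sub, coeff_natCast_mul, coeff_natCast_mul, coeff_X_mul_pderiv,
    coeff_X_mul_pderiv]
  ring

lemma degree_eq_add (m : Fin 2 →₀ ℕ) : m.degree = m 0 + m 1 := by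
  rw [Finsupp.degree_eq_sum]
  simp

lemma exists_coeff_of_coeff_mul_pderiv {n : ℕ} {P : MvPolynomial (Fin 2) 𝕜}
    (hP : P.IsHomogeneous n) (i : Fin 2) {F : MvPowerSeries (Fin 2) 𝕜} {m : Fin 2 →₀ ℕ}
    (h : coeff m ((P : MvPowerSeries (Fin 2) 𝕜) * pderiv 𝕜 i F) ≠ 0) :
    ∃ m', coeff m' F ≠ 0 ∧ m'.degree + n = m.degree + 1 := by
  classical
  rw [coeff_mul] at h
  obtain ⟨⟨a, b⟩, hab, hne⟩ := Finset.exists_ne_zero_of_sum_ne_zero h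
  rw [Finset.HasAntidiagonal.mem_antidiagonal] at hab
  rw [coeff_pderiv, MvPolynomial.coeff_coe] at hne
  refine ⟨b + Finsupp.single i 1, left_ne_zero_of_mul (right_ne_zero_of_mul hne), ?_⟩
  have ha : a.degree = n := by
    by_contra h'
    exact left_ne_zero_of_mul hne (hP.coeff_eq_zero h')
  rw [← hab, map_add, map_add, Finsupp.degree_single, ha]
  ring

/-- A homogeneous vector field of degree `n` raises degrees by `n - 1`. -/
lemma exists_coeff_of_coeff_vectorField {n : ℕ} {P Q : MvPolynomial (Fin 2) 𝕜}
    (hP : P.IsHomogeneous n) (hQ : Q.IsHomogeneous n) {F : MvPowerSeries (Fin 2) 𝕜}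
    {m : Fin 2 →₀ ℕ} (h : coeff m (vectorField (P : MvPowerSeries (Fin 2) 𝕜) Q F) ≠ 0) :
    ∃ m', coeff m' F ≠ 0 ∧ m'.degree + n = m.degree + 1 := by
  rw [vectorField_apply, map_add] at h
  by_cases h0 : coeff m ((P : MvPowerSeries (Fin 2) 𝕜) * pderiv 𝕜 0 F) = 0
  · rw [h0, zero_add] at h
    exact exists_coeff_of_coeff_mul_pderiv hQ 1 h
  · exact exists_coeff_of_coeff_mul_pderiv hP 0 h0

lemma coeff_vectorField_congr {n : ℕ} (hn : 2 ≤ n) {P Q : MvPolynomial (Fin 2) 𝕜}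
    (hP : P.IsHomogeneous n) (hQ : Q.IsHomogeneous n) {F F' : MvPowerSeries (Fin 2) 𝕜} {D : ℕ}
    (h : ∀ m : Fin 2 →₀ ℕ, m.degree < D → coeff m F = coeff m F') {m : Fin 2 →₀ ℕ}
    (hm : m.degree < D + 1) :
    coeff m (vectorField (P : MvPowerSeries (Fin 2) 𝕜) Q F) =
      coeff m (vectorField (P : MvPowerSeries (Fin 2) 𝕜) Q F') := by
  rw [← sub_eq_zero, ← map_sub, ← map_sub]
  by_contra hne
  obtain ⟨m', hm', hdeg⟩ := exists_coeff_of_coeff_vectorField hP hQ hne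
  exact hm' (by rw [map_sub, h m' (by omega), sub_self])

/-- The inverse, up to sign, of the linear part `p x ∂/∂x - q y ∂/∂y` on non-resonant monomials.
On resonant monomials the division by zero makes it vanish. -/
def linInv (p q : ℕ) (F : MvPowerSeries (Fin 2) 𝕜) : MvPowerSeries (Fin 2) 𝕜 :=
  fun m => -coeff m F / ((p : 𝕜) * m 0 - q * m 1)

lemma coeff_linInv (p q : ℕ) (F : MvPowerSeries (Fin 2) 𝕜) (m : Fin 2 →₀ ℕ) :
    coeff m (linInv p q F) = -coeff m F / ((p : 𝕜) * m 0 - q * m 1) := rfl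

/-- Picard iterates of the equation `H = R + linInv (P H_x + Q H_y)`, which says that the resonant
part of `H` is `R` and that `Ḣ` has resonant terms only. -/
def picard (p q : ℕ) (P Q : MvPolynomial (Fin 2) 𝕜) (R : MvPowerSeries (Fin 2) 𝕜) :
    ℕ → MvPowerSeries (Fin 2) 𝕜
  | 0 => R
  | t + 1 => R + linInv p q (vectorField (P : MvPowerSeries (Fin 2) 𝕜) Q (picard p q P Q R t))

/-- The limit of the Picard iterates: a coefficient of degree `D` is constant from the iterate
`D + 1` on. -/
def normalForm (p q : ℕ) (P Q : MvPolynomial (Fin 2) 𝕜) (R : MvPowerSeries (Fin 2) 𝕜) :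
    MvPowerSeries (Fin 2) 𝕜 :=
  fun m => coeff m (picard p q P Q R (m.degree + 1))

lemma coeff_normalForm (p q : ℕ) (P Q : MvPolynomial (Fin 2) 𝕜) (R : MvPowerSeries (Fin 2) 𝕜)
    (m : Fin 2 →₀ ℕ) :
    coeff m (normalForm p q P Q R) = coeff m (picard p q P Q R (m.degree + 1)) := rfl

section

variable {n : ℕ} (hn : 2 ≤ n) {P Q : MvPolynomial (Fin 2) 𝕜}
  (hP : P.IsHomogeneous n) (hQ : Q.IsHomogeneous n)

include hn hP hQ

lemma coeff_picard_succ (p q : ℕ) (R : MvPowerSeries (Fin 2) 𝕜) (t : ℕ) :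
    ∀ m : Fin 2 →₀ ℕ, m.degree < t →
      coeff m (picard p q P Q R t) = coeff m (picard p q P Q R (t + 1)) := by
  induction t with
  | zero => intro m hm; omega
  | succ t ih =>
    intro m hm
    rw [picard, picard, map_add, map_add, coeff_linInv, coeff_linInv,
      coeff_vectorField_congr hn hP hQ ih hm]

lemma coeff_picard_eq_normalForm (p q : ℕ) (R : MvPowerSeries (Fin 2) 𝕜) (m : Fin 2 →₀ ℕ) (t : ℕ)
    (h : m.degree < t) : coeff m (picard p q P Q R t) = coeff m (normalForm p q P Q R) := by
  rw [coeff_normalForm]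
  induction t, h using Nat.le_induction with
  | base => rfl
  | succ t ht ih => rw [← coeff_picard_succ hn hP hQ p q R t m ht, ih]

lemma normalForm_eq (p q : ℕ) (R : MvPowerSeries (Fin 2) 𝕜) :
    normalForm p q P Q R =
      R + linInv p q (vectorField (P : MvPowerSeries (Fin 2) 𝕜) Q (normalForm p q P Q R)) := by
  ext m
  rw [coeff_normalForm, picard, map_add, map_add, coeff_linInv, coeff_linInv,
    coeff_vectorField_congr hn hP hQ (D := m.degree)
      (fun m' h => coeff_picard_eq_normalForm hn hP hQ p q R m' _ h) (Nat.lt_succ_self _)]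

lemma eq_normalForm {p q : ℕ} {R H : MvPowerSeries (Fin 2) 𝕜}
    (hH : H = R + linInv p q (vectorField (P : MvPowerSeries (Fin 2) 𝕜) Q H)) :
    H = normalForm p q P Q R := by
  have key : ∀ t, ∀ m : Fin 2 →₀ ℕ, m.degree < t →
      coeff m H = coeff m (picard p q P Q R t) := by
    intro t
    induction t with
    | zero => intro m hm; omega
    | succ t ih =>
      intro m hm
      rw [hH, picard, map_add, map_add, coeff_linInv, coeff_linInv,
        ← coeff_vectorField_congr hn hP hQ ih hm]
  ext m
  exact key _ m (Nat.lt_succ_self _)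

end

/-- All terms of the series have a degree of the form `r + t a` with `t ≥ 0`. -/
def GradedSupport (r a : ℕ) (F : MvPowerSeries (Fin 2) 𝕜) : Prop :=
  ∀ m : Fin 2 →₀ ℕ, coeff m F ≠ 0 → ∃ t, m.degree = r + t * a

lemma GradedSupport.vectorField {r a : ℕ} {P Q : MvPolynomial (Fin 2) 𝕜}
    (hP : P.IsHomogeneous (a + 1)) (hQ : Q.IsHomogeneous (a + 1)) {F : MvPowerSeries (Fin 2) 𝕜}
    (hF : GradedSupport r a F) :
    GradedSupport (r + a) a (vectorField (P : MvPowerSeries (Fin 2) 𝕜) Q F) := by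
  intro m hm
  obtain ⟨m', hm', hd⟩ := exists_coeff_of_coeff_vectorField hP hQ hm
  obtain ⟨t, ht⟩ := hF m' hm'
  exact ⟨t, by omega⟩

lemma GradedSupport.of_add {r a : ℕ} {F : MvPowerSeries (Fin 2) 𝕜}
    (hF : GradedSupport (r + a) a F) : GradedSupport r a F := by
  intro m hm
  obtain ⟨t, ht⟩ := hF m hm
  exact ⟨t + 1, by rw [ht]; ring⟩

lemma GradedSupport.normalForm {p q r a : ℕ} {P Q : MvPolynomial (Fin 2) 𝕜}
    (hP : P.IsHomogeneous (a + 1)) (hQ : Q.IsHomogeneous (a + 1)) {R : MvPowerSeries (Fin 2) 𝕜}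
    (hR : GradedSupport r a R) : GradedSupport r a (normalForm p q P Q R) := by
  have key : ∀ t, GradedSupport r a (picard p q P Q R t) := by
    intro t
    induction t with
    | zero => exact hR
    | succ t ih =>
      intro m hm
      rw [picard, map_add, coeff_linInv] at hm
      by_cases h0 : coeff m R = 0
      · rw [h0, zero_add] at hm
        refine (ih.vectorField hP hQ).of_add m fun h => hm ?_
        rw [h, neg_zero, zero_div]
      · exact hR m h0
  exact fun m hm => key _ m hm

lemma resExp_zero (p q : ℕ) : resExp p q 0 = q := by simp [resExp]

lemma resExp_one (p q : ℕ) : resExp p q 1 = p := by simp [resExp]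

lemma degree_resExp (p q : ℕ) : (resExp p q).degree = p + q := by
  rw [degree_eq_add, resExp_zero, resExp_one, add_comm]

lemma eq_smul_resExp {p q : ℕ} (hp : 1 ≤ p) (hpq : Nat.Coprime p q) {m : Fin 2 →₀ ℕ}
    (h : p * m 0 = q * m 1) : ∃ t : ℕ, m = t • resExp p q := by
  obtain ⟨t, ht⟩ : p ∣ m 1 := hpq.dvd_of_dvd_mul_left ⟨m 0, h.symm⟩
  refine ⟨t, ?_⟩
  have h0 : m 0 = q * t := by
    apply Nat.eq_of_mul_eq_mul_left hp
    rw [h, ht]; ring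
  ext i
  fin_cases i
  · simp [resExp_zero, h0, mul_comm]
  · simp [resExp_one, ht, mul_comm]

variable [CharZero 𝕜]

lemma resonance_ne_zero {p q : ℕ} {m : Fin 2 →₀ ℕ} (h : p * m 0 ≠ q * m 1) :
    (p : 𝕜) * m 0 - q * m 1 ≠ 0 := by
  rw [sub_ne_zero]
  exact_mod_cast h

lemma coeff_lieDeriv_normalForm {n p q : ℕ} (hn : 2 ≤ n) {P Q : MvPolynomial (Fin 2) 𝕜}
    (hP : P.IsHomogeneous n) (hQ : Q.IsHomogeneous n) {R : MvPowerSeries (Fin 2) 𝕜}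
    {m : Fin 2 →₀ ℕ} (hm : p * m 0 ≠ q * m 1) (hR : coeff m R = 0) :
    coeff m (lieDeriv p q P Q (normalForm p q P Q R)) = 0 := by
  have h := congrArg (coeff m) (normalForm_eq hn hP hQ p q R)
  rw [map_add, hR, zero_add, coeff_linInv, eq_div_iff (resonance_ne_zero hm)] at h
  rw [coeff_lieDeriv, mul_comm, h, neg_add_cancel]

/-- The normal form with a prescribed resonant part satisfies the conditions on `H` in the
definition of saddle values. -/
lemma isSaddleExpansion_normalForm {a p q : ℕ} (ha : 1 ≤ a) (hp : 1 ≤ p)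
    (hpq : Nat.Coprime p q) {P Q : MvPolynomial (Fin 2) 𝕜}
    (hP : P.IsHomogeneous (a + 1)) (hQ : Q.IsHomogeneous (a + 1)) {R : MvPowerSeries (Fin 2) 𝕜}
    (hR : GradedSupport (p + q) a R) (hR1 : coeff (resExp p q) R = 1)
    (hres : ∀ m : Fin 2 →₀ ℕ, p * m 0 ≠ q * m 1 → coeff m R = 0) :
    IsSaddleExpansion p q P Q (normalForm p q P Q R)
      (fun k => coeff ((k + 1) • resExp p q) (lieDeriv p q P Q (normalForm p q P Q R))) := by
  classical
  set H := normalForm p q P Q R with hH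
  have hgr : GradedSupport (p + q) a H := hR.normalForm hP hQ
  have hgr' := hgr.vectorField hP hQ
  have hvf : ∀ m : Fin 2 →₀ ℕ, m.degree ≤ p + q →
      coeff m (vectorField (P : MvPowerSeries (Fin 2) 𝕜) Q H) = 0 := by
    intro m hm
    by_contra h
    obtain ⟨t, ht⟩ := hgr' m h
    omega
  refine ⟨?_, fun k _ => rfl, ?_⟩
  · intro m hm
    have h := congrArg (coeff m) (normalForm_eq (by omega : 2 ≤ a + 1) hP hQ p q R)
    rw [← hH, map_add, coeff_linInv, hvf m hm, neg_zero, zero_div, add_zero] at h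
    rw [h, coeff_monomial]
    split_ifs with hmr
    · rw [hmr, hR1]
    · by_contra hne
      have hr : p * m 0 = q * m 1 := by
        by_contra h'
        exact hne (hres m h')
      obtain ⟨t, rfl⟩ := eq_smul_resExp hp hpq hr
      obtain ⟨u, hu⟩ := hR _ hne
      rw [map_nsmul, degree_resExp, smul_eq_mul] at hu hm
      have h2 : t ≤ 1 := by
        by_contra h'
        have : 2 * (p + q) ≤ t * (p + q) := Nat.mul_le_mul_right _ (by omega)
        omega
      interval_cases t
      · omega
      · exact hmr (one_smul _ _)
  · intro m hm
    by_cases hr : p * m 0 = q * m 1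
    · obtain ⟨t, rfl⟩ := eq_smul_resExp hp hpq hr
      have ht : t ≤ 1 := by
        by_contra h'
        exact hm (t - 1) (by omega) (by rw [Nat.sub_add_cancel (by omega)])
      rw [coeff_lieDeriv, hvf _ ?_, add_zero]
      · have : (p : 𝕜) * ((t • resExp p q) 0 : ℕ) - q * ((t • resExp p q) 1 : ℕ) = 0 := by
          rw [sub_eq_zero]
          exact_mod_cast hr
        rw [this, zero_mul]
      · rw [map_nsmul, degree_resExp, smul_eq_mul]
        exact (Nat.mul_le_mul_right _ ht).trans (one_mul _).le
    · exact coeff_lieDeriv_normalForm (by omega) hP hQ hr (hres m hr)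

end NormalForm

section Smooth

variable {𝕜 V : Type*} [NontriviallyNormedField 𝕜] [NormedAddCommGroup V] [NormedSpace 𝕜 V]

lemma contDiff_coeff_mul_pderiv
    {F : V → MvPowerSeries (Fin 2) 𝕜} {P : V → MvPolynomial (Fin 2) 𝕜}
    (hP : ∀ m, ContDiff 𝕜 1 fun v => (P v).coeff m)
    (hF : ∀ m, ContDiff 𝕜 1 fun v => coeff m (F v)) (i : Fin 2) (m : Fin 2 →₀ ℕ) :
    ContDiff 𝕜 1 fun v => coeff m ((P v : MvPowerSeries (Fin 2) 𝕜) * pderiv 𝕜 i (F v)) := by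
  classical
  simp only [coeff_mul, coeff_pderiv, MvPolynomial.coeff_coe]
  exact ContDiff.sum fun ab _ => (hP _).mul ((hF _).mul contDiff_const)

lemma contDiff_coeff_mul_const {F : V → MvPowerSeries (Fin 2) 𝕜}
    (hF : ∀ m, ContDiff 𝕜 1 fun v => coeff m (F v)) (A : MvPowerSeries (Fin 2) 𝕜)
    (m : Fin 2 →₀ ℕ) : ContDiff 𝕜 1 fun v => coeff m (F v * A) := by
  classical
  simp only [coeff_mul]
  exact ContDiff.sum fun ab _ => (hF _).mul contDiff_const

lemma contDiff_coeff_vectorField {F : V → MvPowerSeries (Fin 2) 𝕜}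
    {P Q : V → MvPolynomial (Fin 2) 𝕜}
    (hP : ∀ m, ContDiff 𝕜 1 fun v => (P v).coeff m)
    (hQ : ∀ m, ContDiff 𝕜 1 fun v => (Q v).coeff m)
    (hF : ∀ m, ContDiff 𝕜 1 fun v => coeff m (F v)) (m : Fin 2 →₀ ℕ) :
    ContDiff 𝕜 1 fun v => coeff m (vectorField (P v : MvPowerSeries (Fin 2) 𝕜) (Q v) (F v)) := by
  simp only [vectorField_apply, map_add]
  exact (contDiff_coeff_mul_pderiv hP hF 0 m).add (contDiff_coeff_mul_pderiv hQ hF 1 m)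

lemma contDiff_coeff_normalForm (p q : ℕ) {P Q : V → MvPolynomial (Fin 2) 𝕜}
    (hP : ∀ m, ContDiff 𝕜 1 fun v => (P v).coeff m)
    (hQ : ∀ m, ContDiff 𝕜 1 fun v => (Q v).coeff m) (R : MvPowerSeries (Fin 2) 𝕜)
    (m : Fin 2 →₀ ℕ) :
    ContDiff 𝕜 1 fun v => coeff m (normalForm p q (P v) (Q v) R) := by
  have key : ∀ t m, ContDiff 𝕜 1 fun v => coeff m (picard p q (P v) (Q v) R t) := by
    intro t
    induction t with
    | zero => exact fun m => contDiff_const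
    | succ t ih =>
      intro m
      simp only [picard, map_add, coeff_linInv]
      exact contDiff_const.add ((contDiff_coeff_vectorField hP hQ ih m).neg.div_const _)
  exact key _ m

end Smooth

/-! ### Powers of `1 + g` with arbitrary exponent -/

section BasePower

variable {𝕜 : Type*} [Field 𝕜]

lemma coeff_mul_eq_zero_of_low {F : MvPowerSeries (Fin 2) 𝕜} {D : ℕ}
    (hF : ∀ m : Fin 2 →₀ ℕ, m.degree < D → coeff m F = 0) (G : MvPowerSeries (Fin 2) 𝕜)
    {m : Fin 2 →₀ ℕ} (hm : m.degree < D) : coeff m (F * G) = 0 := by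
  classical
  rw [coeff_mul]
  refine Finset.sum_eq_zero fun ab hab => ?_
  rw [Finset.HasAntidiagonal.mem_antidiagonal] at hab
  have : m.degree = ab.1.degree + ab.2.degree := by rw [← hab, map_add]
  rw [hF _ (by omega), zero_mul]

lemma coeff_coe_pow_eq_zero {a : ℕ} {g : MvPolynomial (Fin 2) 𝕜} (hg : g.IsHomogeneous a)
    {t : ℕ} {m : Fin 2 →₀ ℕ} (hm : m.degree ≠ a * t) :
    coeff m ((g : MvPowerSeries (Fin 2) 𝕜) ^ t) = 0 := by
  rw [← MvPolynomial.coe_pow, MvPolynomial.coeff_coe]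
  exact (hg.pow t).coeff_eq_zero hm

/-- The coefficients of the binomial series `(1 + t) ^ (-σ)`. -/
def binCoeff (σ : 𝕜) : ℕ → 𝕜
  | 0 => 1
  | t + 1 => -((σ + t) * binCoeff σ t) / (t + 1)

/-- The series `(1 + g) ^ (-σ)`, for `g` homogeneous of positive degree: only the powers `g ^ t` with
`t ≤ m.degree` contribute to the coefficient at `m`. -/
def negPow (g : MvPolynomial (Fin 2) 𝕜) (σ : 𝕜) : MvPowerSeries (Fin 2) 𝕜 :=
  fun m => ∑ t ∈ Finset.range (m.degree + 1),
    binCoeff σ t * coeff m ((g : MvPowerSeries (Fin 2) 𝕜) ^ t)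

lemma coeff_negPow (g : MvPolynomial (Fin 2) 𝕜) (σ : 𝕜) (m : Fin 2 →₀ ℕ) :
    coeff m (negPow g σ) = ∑ t ∈ Finset.range (m.degree + 1),
      binCoeff σ t * coeff m ((g : MvPowerSeries (Fin 2) 𝕜) ^ t) := rfl

lemma constantCoeff_negPow (g : MvPolynomial (Fin 2) 𝕜) (σ : 𝕜) :
    constantCoeff (negPow g σ) = 1 := by
  rw [← coeff_zero_eq_constantCoeff_apply, coeff_negPow]
  simp [binCoeff]

lemma gradedSupport_negPow {a : ℕ} {g : MvPolynomial (Fin 2) 𝕜} (hg : g.IsHomogeneous a) (σ : 𝕜) :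
    GradedSupport 0 a (negPow g σ) := by
  intro m hm
  rw [coeff_negPow] at hm
  obtain ⟨t, -, ht⟩ := Finset.exists_ne_zero_of_sum_ne_zero hm
  refine ⟨t, ?_⟩
  by_contra h
  exact right_ne_zero_of_mul ht (coeff_coe_pow_eq_zero hg (by rw [mul_comm]; omega))

lemma coeff_negPow_of_lt {a : ℕ} (ha : 1 ≤ a) {g : MvPolynomial (Fin 2) 𝕜}
    (hg : g.IsHomogeneous a) (σ : 𝕜) {m : Fin 2 →₀ ℕ} {T : ℕ} (hT : m.degree < T) :
    coeff m (negPow g σ) = coeff m (∑ t ∈ Finset.range T,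
      MvPowerSeries.C (binCoeff σ t) * (g : MvPowerSeries (Fin 2) 𝕜) ^ t) := by
  rw [coeff_negPow, map_sum]
  simp only [coeff_C_mul]
  refine Finset.sum_subset (Finset.range_subset_range.mpr hT) fun t _ ht => ?_
  rw [Finset.mem_range, not_lt] at ht
  rw [coeff_coe_pow_eq_zero hg, mul_zero]
  have : t * 1 ≤ t * a := Nat.mul_le_mul_left _ ha
  rw [mul_comm a]
  omega

variable [CharZero 𝕜]

lemma pderiv_sum_binCoeff (g : MvPowerSeries (Fin 2) 𝕜) (σ : 𝕜) (i : Fin 2) (T : ℕ) :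
    (1 + g) * pderiv 𝕜 i (∑ t ∈ Finset.range (T + 1), MvPowerSeries.C (binCoeff σ t) * g ^ t)
      + MvPowerSeries.C σ * pderiv 𝕜 i g *
        (∑ t ∈ Finset.range (T + 1), MvPowerSeries.C (binCoeff σ t) * g ^ t)
      = g ^ T * (MvPowerSeries.C ((σ + T) * binCoeff σ T) * pderiv 𝕜 i g) := by
  induction T with
  | zero =>
    simp only [zero_add, Finset.sum_range_one, binCoeff, map_one, pow_zero, mul_one,
      Derivation.map_one_eq_zero, Nat.cast_zero, add_zero, mul_zero, one_mul]
  | succ T ih =>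
    rw [Finset.sum_range_succ, map_add, mul_add, mul_add]
    have h : MvPowerSeries.C ((σ + T) * binCoeff σ T) =
        -((T : MvPowerSeries (Fin 2) 𝕜) + 1) * MvPowerSeries.C (binCoeff σ (T + 1)) := by
      have h0 : (T : 𝕜) + 1 ≠ 0 := by exact_mod_cast Nat.succ_ne_zero T
      have : (σ + T) * binCoeff σ T = -((T : 𝕜) + 1) * binCoeff σ (T + 1) := by
        rw [binCoeff]; field_simp
      rw [this]
      simp
    rw [h] at ih
    have h1 : pderiv 𝕜 i (MvPowerSeries.C (binCoeff σ (T + 1)) * g ^ (T + 1)) =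
        MvPowerSeries.C (binCoeff σ (T + 1)) * (((T : MvPowerSeries (Fin 2) 𝕜) + 1) * g ^ T
          * pderiv 𝕜 i g) := by
      rw [Derivation.leibniz, pderiv_C, smul_zero, add_zero, Derivation.leibniz_pow]
      simp only [smul_eq_mul, nsmul_eq_mul, Nat.add_sub_cancel]
      push_cast; ring
    rw [h1]
    simp only [map_mul, map_add, map_natCast]
    push_cast
    linear_combination ih

/-- The differential equation of `U = (1 + g) ^ (-σ)`. -/
lemma pderiv_negPow {a : ℕ} (ha : 1 ≤ a) {g : MvPolynomial (Fin 2) 𝕜}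
    (hg : g.IsHomogeneous a) (σ : 𝕜) (i : Fin 2) :
    (1 + (g : MvPowerSeries (Fin 2) 𝕜)) * pderiv 𝕜 i (negPow g σ)
      + MvPowerSeries.C σ * pderiv 𝕜 i (g : MvPowerSeries (Fin 2) 𝕜) * negPow g σ = 0 := by
  ext m
  set G := (g : MvPowerSeries (Fin 2) 𝕜) with hG
  set T := m.degree + 1 with hT
  set S := ∑ t ∈ Finset.range (T + 1), MvPowerSeries.C (binCoeff σ t) * G ^ t with hS
  have hlow : ∀ m' : Fin 2 →₀ ℕ, m'.degree < T + 1 → coeff m' (negPow g σ - S) = 0 := by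
    intro m' hm'
    rw [map_sub, coeff_negPow_of_lt ha hg σ hm', sub_self]
  have hlow' : ∀ m' : Fin 2 →₀ ℕ, m'.degree < T → coeff m' (pderiv 𝕜 i (negPow g σ - S)) = 0 := by
    intro m' hm'
    rw [coeff_pderiv, hlow _ (by rw [map_add, Finsupp.degree_single]; omega), zero_mul]
  have hpow : ∀ m' : Fin 2 →₀ ℕ, m'.degree < T → coeff m' (G ^ T) = 0 := by
    intro m' hm'
    refine coeff_coe_pow_eq_zero hg ?_
    have : 1 * T ≤ a * T := Nat.mul_le_mul_right _ ha
    omega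
  have h := pderiv_sum_binCoeff G σ i T
  rw [← hS] at h
  have e : (1 + G) * pderiv 𝕜 i (negPow g σ) + MvPowerSeries.C σ * pderiv 𝕜 i G * negPow g σ
      = pderiv 𝕜 i (negPow g σ - S) * (1 + G)
        + (negPow g σ - S) * (MvPowerSeries.C σ * pderiv 𝕜 i G)
        + G ^ T * (MvPowerSeries.C ((σ + T) * binCoeff σ T) * pderiv 𝕜 i G) := by
    rw [map_sub]
    linear_combination h
  rw [e, map_add, map_add, coeff_mul_eq_zero_of_low hlow' _ (Nat.lt_succ_self _),
    coeff_mul_eq_zero_of_low hlow _ (by omega), coeff_mul_eq_zero_of_low hpow _ (Nat.lt_succ_self _)]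
  simp

end BasePower

/-! ### The unperturbed system -/

section BaseSystem

variable {𝕜 : Type*} [Field 𝕜]

lemma natCast_eq_C (a : ℕ) : ((a : ℕ) : MvPowerSeries (Fin 2) 𝕜) = MvPowerSeries.C (a : 𝕜) := by
  simp

/-- Euler's identity. -/
lemma euler_identity {a : ℕ} {g : MvPolynomial (Fin 2) 𝕜} (hg : g.IsHomogeneous a) :
    X 0 * pderiv 𝕜 0 (g : MvPowerSeries (Fin 2) 𝕜) + X 1 * pderiv 𝕜 1 (g : MvPowerSeries (Fin 2) 𝕜)
      = (a : MvPowerSeries (Fin 2) 𝕜) * (g : MvPowerSeries (Fin 2) 𝕜) := by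
  ext m
  rw [map_add, coeff_X_mul_pderiv, coeff_X_mul_pderiv, coeff_natCast_mul, MvPolynomial.coeff_coe]
  by_cases h : m.degree = a
  · rw [degree_eq_add] at h
    rw [← h]; push_cast; ring
  · rw [hg.coeff_eq_zero h]; simp

lemma X_mul_pderiv_monomial (i : Fin 2) (m : Fin 2 →₀ ℕ) :
    X i * pderiv 𝕜 i (monomial m (1 : 𝕜)) = ((m i : ℕ) : MvPowerSeries (Fin 2) 𝕜) * monomial m 1 := by
  classical
  ext m'
  rw [coeff_X_mul_pderiv, coeff_natCast_mul, coeff_monomial]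
  split_ifs with h
  · rw [h]
  · simp

/-- The polynomial `φ` for which `x (p + φ) ∂/∂x + y (-q + φ) ∂/∂y` multiplies `1 + g` by `a φ`,
where `g` is homogeneous of degree `a`. -/
def cofactor (p q a : ℕ) (g : MvPolynomial (Fin 2) 𝕜) : MvPolynomial (Fin 2) 𝕜 :=
  MvPolynomial.C (a : 𝕜)⁻¹ * (MvPolynomial.C (p : 𝕜) * (MvPolynomial.X 0 * MvPolynomial.pderiv 0 g)
    - MvPolynomial.C (q : 𝕜) * (MvPolynomial.X 1 * MvPolynomial.pderiv 1 g))

lemma isHomogeneous_cofactor (p q : ℕ) {a : ℕ} (ha : 1 ≤ a) {g : MvPolynomial (Fin 2) 𝕜}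
    (hg : g.IsHomogeneous a) : (cofactor p q a g).IsHomogeneous a := by
  have h : ∀ i, (MvPolynomial.X i * MvPolynomial.pderiv i g).IsHomogeneous a := fun i => by
    have := (MvPolynomial.isHomogeneous_X 𝕜 i).mul (hg.pderiv (i := i))
    rwa [Nat.add_sub_cancel' ha] at this
  exact (((h 0).C_mul _).sub ((h 1).C_mul _)).C_mul _

/-- The first integral `x ^ q y ^ p (1 + g) ^ (-(p + q) / a)` of the system
`ẋ = x (p + φ)`, `ẏ = y (-q + φ)`. -/
def firstIntegral (p q a : ℕ) (g : MvPolynomial (Fin 2) 𝕜) : MvPowerSeries (Fin 2) 𝕜 :=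
  monomial (resExp p q) 1 * negPow g (((p : 𝕜) + q) / a)

/-- The coefficient of `(X ^ q Y ^ p) ^ (k + 1)` in `F`, where `X = x (1 + g) ^ (-1 / a)` and
`Y = y (1 + g) ^ (-1 / a)` are the coordinates that linearize the system `ẋ = x (p + φ)`,
`ẏ = y (-q + φ)`; here `k (p + q) = (r + 1) a`. The factor that multiplies `F` comes from writing
this coefficient as a residue in the variables `x`, `y`. -/
def linearizedCoeff (p q a : ℕ) (g : MvPolynomial (Fin 2) 𝕜) (k r : ℕ)
    (F : MvPowerSeries (Fin 2) 𝕜) : 𝕜 :=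
  coeff ((k + 1) • resExp p q) (F * ((negPow g (((p : 𝕜) + q) / a))⁻¹ *
    (1 + (g : MvPowerSeries (Fin 2) 𝕜)) ^ r))

lemma negPow_mul_inv (g : MvPolynomial (Fin 2) 𝕜) (σ : 𝕜) :
    negPow g σ * (negPow g σ)⁻¹ = 1 :=
  MvPowerSeries.mul_inv_cancel _ (by rw [constantCoeff_negPow]; exact one_ne_zero)

lemma one_add_coe_ne_zero {a : ℕ} (ha : 1 ≤ a) {g : MvPolynomial (Fin 2) 𝕜}
    (hg : g.IsHomogeneous a) : 1 + (g : MvPowerSeries (Fin 2) 𝕜) ≠ 0 := by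
  intro h
  have := congrArg (coeff 0) h
  rw [map_add, MvPolynomial.coeff_coe, hg.coeff_eq_zero (by rw [map_zero]; omega)] at this
  simp at this

variable [CharZero 𝕜]

lemma natCast_mul_cofactor {p q a : ℕ} (ha : 1 ≤ a) (g : MvPolynomial (Fin 2) 𝕜) :
    (a : MvPowerSeries (Fin 2) 𝕜) * (cofactor p q a g : MvPowerSeries (Fin 2) 𝕜)
      = (p : MvPowerSeries (Fin 2) 𝕜) * (X 0 * pderiv 𝕜 0 (g : MvPowerSeries (Fin 2) 𝕜))
        - (q : MvPowerSeries (Fin 2) 𝕜) * (X 1 * pderiv 𝕜 1 (g : MvPowerSeries (Fin 2) 𝕜)) := by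
  have h0 : (a : 𝕜) ≠ 0 := by exact_mod_cast (by omega : a ≠ 0)
  have : MvPolynomial.C (a : 𝕜) * cofactor p q a g =
      MvPolynomial.C (p : 𝕜) * (MvPolynomial.X 0 * MvPolynomial.pderiv 0 g)
        - MvPolynomial.C (q : 𝕜) * (MvPolynomial.X 1 * MvPolynomial.pderiv 1 g) := by
    rw [cofactor, ← mul_assoc, ← map_mul, mul_inv_cancel₀ h0, map_one, one_mul]
  have h := congrArg (fun P : MvPolynomial (Fin 2) 𝕜 => (P : MvPowerSeries (Fin 2) 𝕜)) this
  have hsub : ∀ A B : MvPolynomial (Fin 2) 𝕜, ((A - B : MvPolynomial (Fin 2) 𝕜) :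
      MvPowerSeries (Fin 2) 𝕜) = A - B := fun A B => by
    ext m; simp [MvPolynomial.coeff_coe]
  simp only [MvPolynomial.coe_mul, hsub, MvPolynomial.coe_C, MvPolynomial.coe_X] at h
  rw [natCast_eq_C, natCast_eq_C, natCast_eq_C, h, pderiv_coe, pderiv_coe]

lemma natCast_mul_C_div {p q a : ℕ} (ha : 1 ≤ a) :
    (a : MvPowerSeries (Fin 2) 𝕜) * MvPowerSeries.C (((p : 𝕜) + q) / a)
      = (p : MvPowerSeries (Fin 2) 𝕜) + (q : MvPowerSeries (Fin 2) 𝕜) := by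
  have h0 : (a : 𝕜) ≠ 0 := by exact_mod_cast (by omega : a ≠ 0)
  rw [natCast_eq_C, ← map_mul, mul_div_cancel₀ _ h0]
  simp

lemma lieDeriv_firstIntegral (p q : ℕ) {a : ℕ} (ha : 1 ≤ a) {g : MvPolynomial (Fin 2) 𝕜}
    (hg : g.IsHomogeneous a) :
    lieDeriv p q (MvPolynomial.X 0 * cofactor p q a g) (MvPolynomial.X 1 * cofactor p q a g)
      (firstIntegral p q a g) = 0 := by
  apply mul_left_cancel₀ (one_add_coe_ne_zero ha hg)
  rw [mul_zero]
  set σ := ((p : 𝕜) + q) / a with hσ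
  have hE := euler_identity hg
  have hc := natCast_mul_cofactor (p := p) (q := q) ha g
  have hs := natCast_mul_C_div (𝕜 := 𝕜) (p := p) (q := q) ha
  have h0 := pderiv_negPow ha hg σ 0
  have h1 := pderiv_negPow ha hg σ 1
  have m0 := X_mul_pderiv_monomial (𝕜 := 𝕜) 0 (resExp p q)
  have m1 := X_mul_pderiv_monomial (𝕜 := 𝕜) 1 (resExp p q)
  rw [resExp_zero] at m0
  rw [resExp_one] at m1
  rw [← hσ] at hs
  rw [lieDeriv, firstIntegral, ← hσ, Derivation.leibniz, Derivation.leibniz]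
  simp only [smul_eq_mul, MvPolynomial.coe_mul, MvPolynomial.coe_X]
  set G := (g : MvPowerSeries (Fin 2) 𝕜)
  set φ := (cofactor p q a g : MvPowerSeries (Fin 2) 𝕜)
  set U := negPow g σ
  set ρ := monomial (resExp p q) (1 : 𝕜)
  set Cσ := MvPowerSeries.C (σ := Fin 2) σ
  linear_combination (p + φ) * X 0 * ρ * h0 + (-q + φ) * X 1 * ρ * h1
    + (1 + G) * U * (p + φ) * m0 + (1 + G) * U * (-q + φ) * m1 - φ * U * ρ * Cσ * hE
    + U * ρ * Cσ * hc - φ * U * ρ * (1 + G) * hs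

/-- The functionals `linearizedCoeff` vanish on derivatives along the unperturbed system. -/
lemma linearizedCoeff_lieDeriv {p q a k r : ℕ} (ha : 1 ≤ a) (hk : k * (p + q) = (r + 1) * a)
    {g : MvPolynomial (Fin 2) 𝕜} (hg : g.IsHomogeneous a) (F : MvPowerSeries (Fin 2) 𝕜) :
    linearizedCoeff p q a g k r (lieDeriv p q (MvPolynomial.X 0 * cofactor p q a g)
      (MvPolynomial.X 1 * cofactor p q a g) F) = 0 := by
  rw [linearizedCoeff]
  set σ := ((p : 𝕜) + q) / a with hσ
  have hE := euler_identity hg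
  have hEφ := euler_identity (isHomogeneous_cofactor p q ha hg)
  have hc := natCast_mul_cofactor (p := p) (q := q) ha g
  have hs := natCast_mul_C_div (𝕜 := 𝕜) (p := p) (q := q) ha
  rw [← hσ] at hs
  have hUV := negPow_mul_inv g σ
  have hU := pderiv_negPow ha hg σ
  have hW := one_add_coe_ne_zero ha hg
  set G := (g : MvPowerSeries (Fin 2) 𝕜)
  set φ := (cofactor p q a g : MvPowerSeries (Fin 2) 𝕜) with hφ
  set U := negPow g σ
  set V := U⁻¹
  set Cσ := MvPowerSeries.C (σ := Fin 2) σ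
  set Ω := V * (1 + G) ^ r with hΩ
  -- `Ω` is the power `(1 + g) ^ (σ + r)` and satisfies the corresponding differential equation
  have hV : ∀ i, (1 + G) * pderiv 𝕜 i V = Cσ * pderiv 𝕜 i G * V := by
    intro i
    have h := congrArg (pderiv 𝕜 i) hUV
    rw [Derivation.leibniz, Derivation.map_one_eq_zero, smul_eq_mul, smul_eq_mul] at h
    linear_combination V * (1 + G) * h - V ^ 2 * hU i
      - ((1 + G) * pderiv 𝕜 i V - Cσ * pderiv 𝕜 i G * V) * hUV
  have hΩd : ∀ i, (1 + G) * pderiv 𝕜 i Ω = (Cσ + r) * pderiv 𝕜 i G * Ω := by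
    intro i
    rw [hΩ, Derivation.leibniz, Derivation.leibniz_pow, map_add, Derivation.map_one_eq_zero]
    simp only [smul_eq_mul, nsmul_eq_mul]
    rcases r with _ | r
    · linear_combination hV i
    · simp only [Nat.add_sub_cancel]
      push_cast
      linear_combination (1 + G) ^ (r + 1) * hV i
  have hk' : (k : MvPowerSeries (Fin 2) 𝕜) * ((p : MvPowerSeries (Fin 2) 𝕜) + (q : MvPowerSeries (Fin 2) 𝕜)) =
      ((r : MvPowerSeries (Fin 2) 𝕜) + 1) * (a : MvPowerSeries (Fin 2) 𝕜) := by
    exact_mod_cast congrArg (Nat.cast (R := MvPowerSeries (Fin 2) 𝕜)) hk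
  clear_value Ω
  -- the divergence condition that makes the derivative, multiplied by `Ω`, a sum of the operators
  -- `x ∂/∂x` and `y ∂/∂y` applied to series, up to a term that cancels at the resonant exponent
  have hdiv : (p : MvPowerSeries (Fin 2) 𝕜) * (X 0 * pderiv 𝕜 0 Ω)
      - (q : MvPowerSeries (Fin 2) 𝕜) * (X 1 * pderiv 𝕜 1 Ω)
      + X 0 * pderiv 𝕜 0 (φ * Ω) + X 1 * pderiv 𝕜 1 (φ * Ω)
      = ((k : MvPowerSeries (Fin 2) 𝕜) + 1) * ((p : MvPowerSeries (Fin 2) 𝕜) + (q : MvPowerSeries (Fin 2) 𝕜)) * (φ * Ω) := by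
    apply mul_left_cancel₀ hW
    rw [Derivation.leibniz _ φ Ω, Derivation.leibniz _ φ Ω]
    simp only [smul_eq_mul]
    linear_combination ((p : MvPowerSeries (Fin 2) 𝕜) + φ) * X 0 * hΩd 0
      + (-(q : MvPowerSeries (Fin 2) 𝕜) + φ) * X 1 * hΩd 1
      + φ * Ω * (Cσ + r) * hE - Ω * (Cσ + r) * hc + (1 + G) * Ω * hEφ
      + (1 + G) * φ * Ω * hs - (1 + G) * φ * Ω * hk'
  have e : lieDeriv p q (MvPolynomial.X 0 * cofactor p q a g)
      (MvPolynomial.X 1 * cofactor p q a g) F * Ω =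
      (p : MvPowerSeries (Fin 2) 𝕜) * (X 0 * pderiv 𝕜 0 (Ω * F))
      - (q : MvPowerSeries (Fin 2) 𝕜) * (X 1 * pderiv 𝕜 1 (Ω * F))
      + X 0 * pderiv 𝕜 0 (φ * Ω * F) + X 1 * pderiv 𝕜 1 (φ * Ω * F)
      - (((k + 1) * (p + q) : ℕ) : MvPowerSeries (Fin 2) 𝕜) * (φ * Ω * F) := by
    rw [lieDeriv]
    simp only [Derivation.leibniz _ Ω F, Derivation.leibniz _ (φ * Ω) F, smul_eq_mul, MvPolynomial.coe_mul, MvPolynomial.coe_X]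
    push_cast
    rw [← hφ]
    linear_combination -F * hdiv
  rw [e]
  simp only [map_sub, map_add, coeff_natCast_mul, coeff_X_mul_pderiv, Finsupp.smul_apply,
    resExp_zero, resExp_one, smul_eq_mul]
  push_cast
  ring

end BaseSystem

/-! ### The matrix of first variations -/

section Entries

variable {𝕜 : Type*} [Field 𝕜]

/-- The exponent of the monomial `x ^ i y ^ j`. -/
def expo (i j : ℕ) : Fin 2 →₀ ℕ := Finsupp.single 0 i + Finsupp.single 1 j

@[simp] lemma expo_zero (i j : ℕ) : expo i j 0 = i := by simp [expo]

@[simp] lemma expo_one (i j : ℕ) : expo i j 1 = j := by simp [expo]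

@[simp] lemma degree_expo (i j : ℕ) : (expo i j).degree = i + j := by simp [degree_eq_add]

lemma ext_expo {m m' : Fin 2 →₀ ℕ} (h0 : m 0 = m' 0) (h1 : m 1 = m' 1) : m = m' := by
  ext i
  fin_cases i
  · exact h0
  · exact h1

lemma coeff_single_add_X_mul (i : Fin 2) (m : Fin 2 →₀ ℕ) (F : MvPowerSeries (Fin 2) 𝕜) :
    coeff (Finsupp.single i 1 + m) (X i * F) = coeff m F := by
  rw [X, coeff_add_monomial_mul, one_mul]

variable (𝕜) in
/-- The polynomial `g = x ^ c (x + y) ^ N` that defines the unperturbed system. -/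
def seed (c N : ℕ) : MvPolynomial (Fin 2) 𝕜 :=
  MvPolynomial.X 0 ^ c * (MvPolynomial.X 1 + MvPolynomial.X 0) ^ N

lemma isHomogeneous_seed (c N : ℕ) : (seed 𝕜 c N).IsHomogeneous (N + c) := by
  have h := ((MvPolynomial.isHomogeneous_X 𝕜 (0 : Fin 2)).pow c).mul
    (((MvPolynomial.isHomogeneous_X 𝕜 (1 : Fin 2)).add (MvPolynomial.isHomogeneous_X 𝕜 0)).pow N)
  rw [one_mul, one_mul] at h
  rwa [seed, add_comm N c]

lemma coeff_seed_pow (c N r : ℕ) {m : Fin 2 →₀ ℕ} (hm : m 0 + m 1 = (N + c) * r) :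
    (seed 𝕜 c N ^ r).coeff m = ((N * r).choose (m 1) : 𝕜) := by
  classical
  have e : ∀ j ∈ Finset.range (N * r + 1), (MvPolynomial.X 0 ^ (c * r) * (MvPolynomial.X 1 ^ j *
      MvPolynomial.X 0 ^ (N * r - j) * (((N * r).choose j : ℕ) : MvPolynomial (Fin 2) 𝕜))) =
      MvPolynomial.monomial (expo (c * r + (N * r - j)) j) ((N * r).choose j : 𝕜) := by
    intro j _
    rw [expo, MvPolynomial.monomial_single_add, ← MvPolynomial.C_mul_X_pow_eq_monomial, pow_add,
      map_natCast]
    ring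
  rw [seed, mul_pow, ← pow_mul, ← pow_mul, add_pow, Finset.mul_sum, Finset.sum_congr rfl e,
    MvPolynomial.coeff_sum]
  simp only [MvPolynomial.coeff_monomial]
  by_cases h : m 1 ≤ N * r
  · rw [Finset.sum_eq_single (m 1)]
    · rw [if_pos]
      refine ext_expo ?_ (by simp)
      rw [expo_zero]
      rw [add_mul] at hm
      omega
    · intro j _ hj
      rw [if_neg]
      rintro rfl
      simp at hj
    · intro h'
      exact absurd (Finset.mem_range.mpr (by omega)) h'
  · rw [Nat.choose_eq_zero_of_lt (by omega), Nat.cast_zero]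
    refine Finset.sum_eq_zero fun j hj => ?_
    rw [if_neg]
    rintro rfl
    rw [Finset.mem_range] at hj
    simp at h
    omega

lemma coeff_one_add_pow {a : ℕ} (ha : 1 ≤ a) {g : MvPolynomial (Fin 2) 𝕜} (hg : g.IsHomogeneous a)
    (r : ℕ) {m : Fin 2 →₀ ℕ} (hm : m.degree = a * r) :
    coeff m ((1 + (g : MvPowerSeries (Fin 2) 𝕜)) ^ r) = (g ^ r).coeff m := by
  rw [add_comm, add_pow, map_sum, Finset.sum_eq_single r]
  · simp [← MvPolynomial.coe_pow, MvPolynomial.coeff_coe]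
  · intro j _ hj
    rw [one_pow, mul_one, mul_comm, coeff_natCast_mul, coeff_coe_pow_eq_zero hg, mul_zero]
    rw [hm]
    exact fun h => hj (Nat.eq_of_mul_eq_mul_left ha h).symm
  · simp

variable (𝕜) in
/-- The `x`-component of the `l`-th perturbation. -/
def pertP (a l : ℕ) : MvPolynomial (Fin 2) 𝕜 :=
  if l = 0 then 0 else MvPolynomial.monomial (expo (a + 1 - l) l) 1

variable (𝕜) in
/-- The `y`-component of the `l`-th perturbation. -/
def pertQ (a l : ℕ) : MvPolynomial (Fin 2) 𝕜 :=
  if l = 0 then MvPolynomial.monomial (expo (a + 1 - l) l) 1 else 0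

/-- The variable with respect to which the `l`-th perturbation differentiates. -/
def pertVar (l : ℕ) : Fin 2 := if l = 0 then 1 else 0

lemma isHomogeneous_pertP {a l : ℕ} (hl : l ≤ a + 1) : (pertP 𝕜 a l).IsHomogeneous (a + 1) := by
  unfold pertP
  split_ifs
  · exact MvPolynomial.isHomogeneous_zero _ _ _
  · exact MvPolynomial.isHomogeneous_monomial _ (by rw [degree_expo]; omega)

lemma isHomogeneous_pertQ {a l : ℕ} (hl : l ≤ a + 1) : (pertQ 𝕜 a l).IsHomogeneous (a + 1) := by
  unfold pertQ
  split_ifs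
  · exact MvPolynomial.isHomogeneous_monomial _ (by rw [degree_expo]; omega)
  · exact MvPolynomial.isHomogeneous_zero _ _ _

lemma vectorField_pert (a l : ℕ) (F : MvPowerSeries (Fin 2) 𝕜) :
    vectorField (pertP 𝕜 a l : MvPowerSeries (Fin 2) 𝕜) (pertQ 𝕜 a l) F =
      monomial (expo (a + 1 - l) l) 1 * pderiv 𝕜 (pertVar l) F := by
  rw [vectorField_apply, pertP, pertQ, pertVar]
  split_ifs <;> simp [MvPolynomial.coe_monomial]

lemma vectorField_firstIntegral_mul (p q a r : ℕ) (g : MvPolynomial (Fin 2) 𝕜)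
    (D : Derivation 𝕜 (MvPowerSeries (Fin 2) 𝕜) (MvPowerSeries (Fin 2) 𝕜)) :
    D (firstIntegral p q a g) * ((negPow g (((p : 𝕜) + q) / a))⁻¹ *
      (1 + (g : MvPowerSeries (Fin 2) 𝕜)) ^ r) =
    (1 + (g : MvPowerSeries (Fin 2) 𝕜)) ^ r * D (monomial (resExp p q) 1) +
      monomial (resExp p q) 1 * (D (negPow g (((p : 𝕜) + q) / a)) *
        ((negPow g (((p : 𝕜) + q) / a))⁻¹ * (1 + (g : MvPowerSeries (Fin 2) 𝕜)) ^ r)) := by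
  rw [firstIntegral, Derivation.leibniz]
  simp only [smul_eq_mul]
  linear_combination (1 + (g : MvPowerSeries (Fin 2) 𝕜)) ^ r * D (monomial (resExp p q) 1) *
    negPow_mul_inv g (((p : 𝕜) + q) / a)

variable [CharZero 𝕜]

/-- The first variation of the derivative of the first integral. Only the polynomial `(1 + g) ^ r`
is left of the powers of `1 + g`. -/
lemma natCast_mul_variation {a : ℕ} (ha : 1 ≤ a) {g : MvPolynomial (Fin 2) 𝕜}
    (hg : g.IsHomogeneous a) (p q r : ℕ) (μ : Fin 2 →₀ ℕ) (i : Fin 2) :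
    (r : MvPowerSeries (Fin 2) 𝕜) * (X i * ((monomial μ 1 * pderiv 𝕜 i (firstIntegral p q a g)) *
      ((negPow g (((p : 𝕜) + q) / a))⁻¹ * (1 + (g : MvPowerSeries (Fin 2) 𝕜)) ^ r))) =
    monomial (μ + resExp p q) 1 *
      (((r * resExp p q i : ℕ) : MvPowerSeries (Fin 2) 𝕜) *
          (1 + (g : MvPowerSeries (Fin 2) 𝕜)) ^ r
        - MvPowerSeries.C (((p : 𝕜) + q) / a) *
          (X i * pderiv 𝕜 i ((1 + (g : MvPowerSeries (Fin 2) 𝕜)) ^ r))) := by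
  set σ := ((p : 𝕜) + q) / a with hσ
  have h := vectorField_firstIntegral_mul p q a r g (pderiv 𝕜 i)
  rw [← hσ] at h
  have hm : (monomial (μ + resExp p q) (1 : 𝕜) : MvPowerSeries (Fin 2) 𝕜) =
      monomial μ 1 * monomial (resExp p q) 1 := by
    rw [monomial_mul_monomial, one_mul]
  have hi := X_mul_pderiv_monomial (𝕜 := 𝕜) i (resExp p q)
  have hU := pderiv_negPow ha hg σ i
  have hUV := negPow_mul_inv g σ
  rw [hm]
  set G := (g : MvPowerSeries (Fin 2) 𝕜)
  set U := negPow g σ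
  set V := U⁻¹
  -- this is why both sides carry the factor `r`
  have hpow : (r : MvPowerSeries (Fin 2) 𝕜) * (pderiv 𝕜 i U * (V * (1 + G) ^ r)) =
      -(MvPowerSeries.C σ * pderiv 𝕜 i ((1 + G) ^ r)) := by
    rw [Derivation.leibniz_pow, map_add, Derivation.map_one_eq_zero]
    simp only [smul_eq_mul, nsmul_eq_mul]
    rcases r with _ | r
    · simp
    · simp only [Nat.add_sub_cancel]
      push_cast
      linear_combination ((r : MvPowerSeries (Fin 2) 𝕜) + 1) * V * (1 + G) ^ r * hU
        - ((r : MvPowerSeries (Fin 2) 𝕜) + 1) * (1 + G) ^ r * MvPowerSeries.C σ * pderiv 𝕜 i G * hUV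
  push_cast
  linear_combination (r : MvPowerSeries (Fin 2) 𝕜) * X i * monomial μ (1 : 𝕜) * h
    + (r : MvPowerSeries (Fin 2) 𝕜) * monomial μ (1 : 𝕜) * (1 + G) ^ r * hi
    + X i * monomial μ (1 : 𝕜) * monomial (resExp p q) (1 : 𝕜) * hpow

variable (𝕜) in
/-- The weight of column `l` in the matrix of first variations. It vanishes only if
`a p = (p + q) l`. -/
def weight (p q a l : ℕ) : 𝕜 :=
  if l = 0 then -((a : 𝕜) * p + (p + q)) else (a : 𝕜) * p - (p + q) * l

/-- The matrix of first variations consists of weighted binomial coefficients. For `r = 0` both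
sides vanish, and `linearizedCoeff_variation_resonant` takes over. -/
lemma linearizedCoeff_variation {p q c N k r l : ℕ} (ha : 1 ≤ N + c)
    (hk : k * (p + q) = (r + 1) * (N + c)) (hl : l ≤ N + c + 1) :
    ((N + c : ℕ) : 𝕜) * r * linearizedCoeff p q (N + c) (seed 𝕜 c N) k r
      (vectorField (pertP 𝕜 (N + c) l : MvPowerSeries (Fin 2) 𝕜) (pertQ 𝕜 (N + c) l)
        (firstIntegral p q (N + c) (seed 𝕜 c N))) =
    weight 𝕜 p q (N + c) l *
      (if l = 0 then (N * r).choose (k * p + 1) else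
        if l ≤ k * p then (N * r).choose (k * p - l) else 0 : ℕ) := by
  classical
  set a := N + c with hadef
  have hg : (seed 𝕜 c N).IsHomogeneous a := isHomogeneous_seed c N
  set i := pertVar l with hi
  set μ := expo (a + 1 - l) l with hμ
  set σ := ((p : 𝕜) + q) / a with hσ
  have ha0 : (a : 𝕜) ≠ 0 := by exact_mod_cast (by omega : a ≠ 0)
  have hσa : (a : 𝕜) * σ = p + q := mul_div_cancel₀ _ ha0
  rw [linearizedCoeff, vectorField_pert, ← hσ]
  have h := congrArg (coeff ((k + 1) • resExp p q + Finsupp.single i 1))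
    (natCast_mul_variation ha hg p q r μ i)
  rw [← hσ, add_comm ((k + 1) • resExp p q), coeff_natCast_mul, coeff_single_add_X_mul,
    coeff_monomial_mul] at h
  rw [mul_assoc, h]
  have hkk : k * p + k * q = r * a + a := by rw [← mul_add, hk]; ring
  have hkk' : ((k : 𝕜) * p + k * q) = r * a + a := by exact_mod_cast hkk
  have hNr : N * r ≤ r * a := by rw [hadef, mul_comm]; exact Nat.mul_le_mul_left _ (by omega)
  have hmm : ∀ m : Fin 2 →₀ ℕ, m 0 + m 1 = a * r →
      coeff m (((r * resExp p q i : ℕ) : MvPowerSeries (Fin 2) 𝕜) *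
          (1 + (seed 𝕜 c N : MvPowerSeries (Fin 2) 𝕜)) ^ r
        - MvPowerSeries.C σ *
          (X i * pderiv 𝕜 i ((1 + (seed 𝕜 c N : MvPowerSeries (Fin 2) 𝕜)) ^ r))) =
      ((r : 𝕜) * resExp p q i - σ * m i) * (N * r).choose (m 1) := by
    intro m hm
    rw [map_sub, coeff_natCast_mul, coeff_C_mul, coeff_X_mul_pderiv,
      coeff_one_add_pow ha hg r (by rw [degree_eq_add, hm]), coeff_seed_pow c N r hm]
    push_cast; ring
  rcases Nat.eq_zero_or_pos l with hl0 | hl0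
  · have hi1 : i = 1 := by simp [hi, pertVar, hl0]
    rw [hi1]
    rw [hi1] at hmm
    simp only [hl0, if_true, weight]
    split_ifs with hle
    · have h0 := hle 0
      simp [hμ, resExp_zero, hl0] at h0
      rw [one_mul, hmm]
      · simp [hμ, resExp_one, hl0]
        have e1 : 1 + (k + 1) * p - p = k * p + 1 := by rw [add_mul]; omega
        rw [e1]
        push_cast
        linear_combination ((N * r).choose (k * p + 1) : 𝕜) * (-((k : 𝕜) * p + 1) * hσa - p * hkk')
      · simp [hμ, resExp_zero, resExp_one, hl0]
        rw [add_mul] at h0 ⊢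
        rw [add_mul, mul_comm a r]
        omega
    · rw [Nat.choose_eq_zero_of_lt]
      · simp
      · by_contra hcon
        apply hle
        intro j
        fin_cases j
        · simp [hμ, resExp_zero, hl0]
          rw [add_mul]
          omega
        · simp [hμ, resExp_one, hl0]
          rw [add_mul]
          omega
  · have hi0 : i = 0 := by simp [hi, pertVar, hl0.ne']
    rw [hi0]
    rw [hi0] at hmm
    simp only [hl0.ne', if_false, weight]
    split_ifs with hle hlk hlk
    · have h0 := hle 0
      simp [hμ, resExp_zero] at h0
      rw [one_mul, hmm]
      · simp [hμ, resExp_zero, resExp_one]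
        have e1 : (k + 1) * p - (l + p) = k * p - l := by rw [add_mul]; omega
        have e2 : ((1 + (k + 1) * q - (a + 1 - l + q) : ℕ) : 𝕜) = k * q + l - a := by
          rw [eq_sub_iff_add_eq]
          norm_cast
          rw [add_mul] at h0 ⊢
          omega
        rw [e1, e2]
        linear_combination ((N * r).choose (k * p - l) : 𝕜) *
          (-((k : 𝕜) * q + l - a) * hσa - q * hkk')
      · simp [hμ, resExp_zero, resExp_one]
        rw [add_mul] at h0 ⊢
        rw [add_mul, mul_comm a r]
        omega
    · exfalso
      have h1 := hle 1
      simp [hμ, resExp_one] at h1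
      rw [add_mul] at h1
      omega
    · rw [Nat.choose_eq_zero_of_lt]
      · simp
      · by_contra hcon
        apply hle
        intro j
        fin_cases j
        · simp [hμ, resExp_zero]
          rw [add_mul]
          omega
        · simp [hμ, resExp_one]
          rw [add_mul]
          omega
    · simp

end Entries

/-! ### Perturbation of the integrable system -/

section Analysis

open Topology Filter

/-- A consequence of the inverse function theorem: a map `v ↦ τ(v) v` with `τ(0)` invertible takes
small values in the direction of each coordinate axis. -/
lemma exists_mulVec_eq_single {𝕜 : Type*} [RCLike 𝕜] {m : ℕ}
    {τ : Fin m → Fin m → (Fin m → 𝕜) → 𝕜} (hτ : ∀ i l, ContDiff 𝕜 1 (τ i l))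
    (hinj : ∀ δ : Fin m → 𝕜, (∀ i, ∑ l, δ l * τ i l 0 = 0) → δ = 0) (j : Fin m) :
    ∃ v : Fin m → 𝕜, ∃ ε : 𝕜, ε ≠ 0 ∧
      ∀ i, ∑ l, v l * τ i l v = (Pi.single j ε : Fin m → 𝕜) i := by
  set f : (Fin m → 𝕜) → (Fin m → 𝕜) := fun v i => ∑ l, v l * τ i l v with hf
  set A : (Fin m → 𝕜) →L[𝕜] (Fin m → 𝕜) := ContinuousLinearMap.pi fun i =>
    ∑ l, τ i l 0 • ContinuousLinearMap.proj (R := 𝕜) (φ := fun _ : Fin m => 𝕜) l with hA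
  have hAapp : ∀ δ i, A δ i = ∑ l, δ l * τ i l 0 := fun δ i => by
    simp [hA, mul_comm]
  have hfc : ContDiff 𝕜 1 f := contDiff_pi.mpr fun i =>
    ContDiff.sum fun l _ => (contDiff_apply 𝕜 𝕜 l).mul (hτ i l)
  have hfd : HasFDerivAt f A 0 := by
    rw [hasFDerivAt_pi']
    intro i
    have h1 : ∀ l ∈ Finset.univ, HasFDerivAt (fun v : Fin m → 𝕜 => v l * τ i l v)
        (τ i l 0 • ContinuousLinearMap.proj (R := 𝕜) (φ := fun _ : Fin m => 𝕜) l) 0 := by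
      intro l _
      have h2 := ((hτ i l).differentiable one_ne_zero 0).hasFDerivAt
      have h3 := (hasFDerivAt_apply (𝕜 := 𝕜) l (0 : Fin m → 𝕜)).mul h2
      refine h3.congr_fderiv (ContinuousLinearMap.ext fun δ => ?_)
      change (0 : 𝕜) * _ + _ = _
      rw [zero_mul, zero_add]
      rfl
    refine (HasFDerivAt.fun_sum h1).congr_fderiv ?_
    ext δ
    simp [hAapp, mul_comm]
  have hsurj : A.range = ⊤ := by
    rw [LinearMap.range_eq_top]
    refine LinearMap.injective_iff_surjective.mp ?_
    rw [injective_iff_map_eq_zero]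
    intro δ hδ
    refine hinj δ fun i => ?_
    rw [← hAapp]
    exact congrFun hδ i
  have hmap := (hfc.contDiffAt.hasStrictFDerivAt' hfd one_ne_zero).map_nhds_eq_of_surj hsurj
  have h0 : f 0 = 0 := by
    funext i
    simp [hf]
  have hrange : Set.range f ∈ 𝓝 (0 : Fin m → 𝕜) := by
    rw [← h0, ← hmap]
    exact range_mem_map
  have hcont : Tendsto (fun ε : 𝕜 => (Pi.single j ε : Fin m → 𝕜)) (𝓝 0) (𝓝 0) := by
    have h : Continuous (fun ε : 𝕜 => (Pi.single j ε : Fin m → 𝕜)) :=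
      continuous_pi fun i => by
        by_cases hi : i = j
        · subst hi
          simpa using continuous_id'
        · simpa [hi] using continuous_const
    have := h.tendsto 0
    rwa [Pi.single_zero] at this
  have hev : ∀ᶠ ε in 𝓝[≠] (0 : 𝕜), (Pi.single j ε : Fin m → 𝕜) ∈ Set.range f :=
    (hcont.eventually hrange).filter_mono nhdsWithin_le_nhds
  obtain ⟨ε, ⟨v, hv⟩, hε⟩ := (hev.and eventually_mem_nhdsWithin).exists
  exact ⟨v, ε, hε, fun i => congrFun hv i⟩

end Analysis

section Assembly

variable {𝕜 : Type*} [Field 𝕜]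

lemma coeff_mul_of_low {F : MvPowerSeries (Fin 2) 𝕜} {m : Fin 2 →₀ ℕ}
    (hF : ∀ m' : Fin 2 →₀ ℕ, m'.degree < m.degree → coeff m' F = 0) (G : MvPowerSeries (Fin 2) 𝕜) :
    coeff m (F * G) = coeff m F * constantCoeff G := by
  classical
  rw [coeff_mul, Finset.sum_eq_single (m, 0)]
  · simp
  · rintro ⟨b, b'⟩ hb hne
    rw [Finset.HasAntidiagonal.mem_antidiagonal] at hb
    simp only at hb
    rw [hF b, zero_mul]
    rw [← hb, map_add]
    have : b'.degree ≠ 0 := by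
      rw [ne_eq, Finsupp.degree_eq_zero_iff]
      rintro rfl
      exact hne (by rw [← hb, add_zero])
    omega
  · intro h
    exact absurd (by simp) h

lemma linearizedCoeff_of_low {a : ℕ} (ha : 1 ≤ a) {g : MvPolynomial (Fin 2) 𝕜}
    (hg : g.IsHomogeneous a) {p q k r : ℕ} {F : MvPowerSeries (Fin 2) 𝕜}
    (hF : ∀ m' : Fin 2 →₀ ℕ, m'.degree < (k + 1) * (p + q) → coeff m' F = 0) :
    linearizedCoeff p q a g k r F = coeff ((k + 1) • resExp p q) F := by
  rw [linearizedCoeff, coeff_mul_of_low]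
  · have : constantCoeff (g : MvPowerSeries (Fin 2) 𝕜) = 0 := by
      rw [← coeff_zero_eq_constantCoeff_apply, MvPolynomial.coeff_coe,
        hg.coeff_eq_zero (by rw [map_zero]; omega)]
    simp [this, constantCoeff_negPow]
  · rwa [map_nsmul, degree_resExp, smul_eq_mul]

/-- The part of a series that consists of the monomials `x ^ i y ^ j` with `p i = q j`. -/
def resonantPart (p q : ℕ) (F : MvPowerSeries (Fin 2) 𝕜) : MvPowerSeries (Fin 2) 𝕜 :=
  fun m => if p * m 0 = q * m 1 then coeff m F else 0

lemma coeff_resonantPart (p q : ℕ) (F : MvPowerSeries (Fin 2) 𝕜) (m : Fin 2 →₀ ℕ) :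
    coeff m (resonantPart p q F) = if p * m 0 = q * m 1 then coeff m F else 0 := rfl

lemma gradedSupport_firstIntegral (p q : ℕ) {a : ℕ} {g : MvPolynomial (Fin 2) 𝕜}
    (hg : g.IsHomogeneous a) : GradedSupport (p + q) a (firstIntegral p q a g) := by
  classical
  intro m hm
  rw [firstIntegral, coeff_monomial_mul] at hm
  split_ifs at hm with h
  · obtain ⟨t, ht⟩ := gradedSupport_negPow hg _ _ (right_ne_zero_of_mul hm)
    refine ⟨t, ?_⟩
    have h2 : m = (m - resExp p q) + resExp p q := (tsub_add_cancel_of_le h).symm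
    rw [h2, map_add, ht, degree_resExp]
    ring
  · exact absurd rfl hm

lemma coeff_resExp_firstIntegral (p q a : ℕ) (g : MvPolynomial (Fin 2) 𝕜) :
    coeff (resExp p q) (firstIntegral p q a g) = 1 := by
  classical
  rw [firstIntegral, coeff_monomial_mul, if_pos le_rfl, tsub_self, one_mul,
    coeff_zero_eq_constantCoeff_apply, constantCoeff_negPow]

/-- A component of the perturbed system, with `pert` either `pertP` or `pertQ`. -/
def perturbed (a : ℕ) (P₀ : MvPolynomial (Fin 2) 𝕜) (pert : ℕ → ℕ → MvPolynomial (Fin 2) 𝕜)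
    (v : Fin (a + 1 + 1) → 𝕜) : MvPolynomial (Fin 2) 𝕜 :=
  P₀ + ∑ l, MvPolynomial.C (v l) * pert a l

lemma isHomogeneous_perturbed {a : ℕ} {P₀ : MvPolynomial (Fin 2) 𝕜}
    {pert : ℕ → ℕ → MvPolynomial (Fin 2) 𝕜} (h₀ : P₀.IsHomogeneous (a + 1))
    (h : ∀ l ≤ a + 1, (pert a l).IsHomogeneous (a + 1)) (v : Fin (a + 1 + 1) → 𝕜) :
    (perturbed a P₀ pert v).IsHomogeneous (a + 1) :=
  h₀.add (MvPolynomial.IsHomogeneous.sum _ _ _ fun l _ => (h l (by omega)).C_mul _)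

lemma perturbed_zero (a : ℕ) (P₀ : MvPolynomial (Fin 2) 𝕜)
    (pert : ℕ → ℕ → MvPolynomial (Fin 2) 𝕜) : perturbed a P₀ pert 0 = P₀ := by
  simp [perturbed]

lemma coe_perturbed (a : ℕ) (P₀ : MvPolynomial (Fin 2) 𝕜)
    (pert : ℕ → ℕ → MvPolynomial (Fin 2) 𝕜) (v : Fin (a + 1 + 1) → 𝕜) :
    (perturbed a P₀ pert v : MvPowerSeries (Fin 2) 𝕜) =
      P₀ + ∑ l, MvPowerSeries.C (v l) * (pert a l : MvPowerSeries (Fin 2) 𝕜) := by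
  ext m
  simp [perturbed, MvPolynomial.coeff_coe, MvPolynomial.coeff_sum]

lemma lieDeriv_perturbed (p q a : ℕ) (P₀ Q₀ : MvPolynomial (Fin 2) 𝕜)
    (v : Fin (a + 1 + 1) → 𝕜) (F : MvPowerSeries (Fin 2) 𝕜) :
    lieDeriv p q (perturbed a P₀ (pertP 𝕜) v) (perturbed a Q₀ (pertQ 𝕜) v) F =
      lieDeriv p q P₀ Q₀ F + ∑ l : Fin (a + 1 + 1), MvPowerSeries.C (v l) *
        vectorField (pertP 𝕜 a l : MvPowerSeries (Fin 2) 𝕜) (pertQ 𝕜 a l) F := by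
  simp only [lieDeriv, vectorField_apply, coe_perturbed, mul_add, Finset.sum_add_distrib,
    add_mul, Finset.sum_mul, mul_assoc]
  ring

lemma linearizedCoeff_add_sum {ι : Type*} [Fintype ι] (p q a : ℕ) (g : MvPolynomial (Fin 2) 𝕜)
    (k r : ℕ) (F : MvPowerSeries (Fin 2) 𝕜) (v : ι → 𝕜) (G : ι → MvPowerSeries (Fin 2) 𝕜) :
    linearizedCoeff p q a g k r (F + ∑ l, MvPowerSeries.C (v l) * G l) =
      linearizedCoeff p q a g k r F + ∑ l, v l * linearizedCoeff p q a g k r (G l) := by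
  simp only [linearizedCoeff, add_mul, Finset.sum_mul, map_add, map_sum, mul_assoc, coeff_C_mul]

/-- The entry of the matrix of first variations at which the weight vanishes, in the case that
`a / (p + q)` is an integer. -/
lemma linearizedCoeff_variation_resonant {p q a e : ℕ} (ha : 1 ≤ a) (hp : 1 ≤ p) (he : 1 ≤ e)
    (hea : e * (p + q) = a) {g : MvPolynomial (Fin 2) 𝕜} (hg : g.IsHomogeneous a) :
    linearizedCoeff p q a g e 0
      (vectorField (pertP 𝕜 a (e * p) : MvPowerSeries (Fin 2) 𝕜) (pertQ 𝕜 a (e * p))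
        (firstIntegral p q a g)) = q := by
  classical
  have hl0 : e * p ≠ 0 := Nat.mul_ne_zero (by omega) (by omega)
  have hP := isHomogeneous_pertP (𝕜 := 𝕜) (a := a) (l := e * p) (by rw [← hea, mul_add]; omega)
  have hQ := isHomogeneous_pertQ (𝕜 := 𝕜) (a := a) (l := e * p) (by rw [← hea, mul_add]; omega)
  have hα : a + 1 - e * p = e * q + 1 := by rw [← hea, mul_add]; omega
  rw [linearizedCoeff, vectorField_firstIntegral_mul, map_add, pow_zero, one_mul, mul_one]
  set U := negPow g (((p : 𝕜) + q) / a)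
  have h1 : coeff ((e + 1) • resExp p q) (vectorField (pertP 𝕜 a (e * p) :
      MvPowerSeries (Fin 2) 𝕜) (pertQ 𝕜 a (e * p)) (monomial (resExp p q) 1)) = q := by
    rw [vectorField_pert, pertVar, if_neg hl0, hα,
      ← coeff_single_add_X_mul 0, mul_left_comm, X_mul_pderiv_monomial, resExp_zero, mul_left_comm,
      coeff_natCast_mul, monomial_mul_monomial, one_mul, coeff_monomial, if_pos, mul_one]
    refine ext_expo ?_ ?_
    · simp [resExp_zero]; ring
    · simp [resExp_one]; ring
  have hlow : ∀ m : Fin 2 →₀ ℕ, m.degree < a + a → coeff m (vectorField (pertP 𝕜 a (e * p) :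
      MvPowerSeries (Fin 2) 𝕜) (pertQ 𝕜 a (e * p)) U) = 0 := by
    intro m hm
    by_contra hne
    have h2 : vectorField (pertP 𝕜 a (e * p) : MvPowerSeries (Fin 2) 𝕜) (pertQ 𝕜 a (e * p)) U =
        vectorField (pertP 𝕜 a (e * p) : MvPowerSeries (Fin 2) 𝕜) (pertQ 𝕜 a (e * p)) (U - 1) := by
      rw [map_sub, Derivation.map_one_eq_zero, sub_zero]
    rw [h2] at hne
    obtain ⟨m', hm', hd⟩ := exists_coeff_of_coeff_vectorField hP hQ hne
    have hm0 : m' ≠ 0 := by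
      rintro rfl
      apply hm'
      rw [map_sub, coeff_zero_eq_constantCoeff_apply, constantCoeff_negPow]
      simp
    rw [map_sub, coeff_one, if_neg hm0, sub_zero] at hm'
    obtain ⟨t, ht⟩ := gradedSupport_negPow hg _ _ hm'
    have ht0 : t ≠ 0 := by
      rintro rfl
      rw [zero_mul, add_zero] at ht
      exact hm0 ((Finsupp.degree_eq_zero_iff _).mp ht)
    have : 1 * a ≤ t * a := Nat.mul_le_mul_right _ (by omega)
    omega
  rw [h1, coeff_monomial_mul]
  split_ifs with hle
  · rw [coeff_mul_eq_zero_of_low hlow, mul_zero, add_zero]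
    have h3 := congrArg Finsupp.degree (tsub_add_cancel_of_le hle)
    rw [map_add, degree_resExp, map_nsmul, degree_resExp, smul_eq_mul] at h3
    rw [add_mul, hea] at h3
    omega
  · rw [add_zero]

variable [CharZero 𝕜]

/-- The matrix of first variations is injective. If the weight of a column vanishes, then `s = 1`,
and injectivity of the binomial matrix leaves a vector supported on that column, whose entry in the
first row is `q`. -/
lemma variation_injective {p q c N e s B : ℕ} (hp : 1 ≤ p) (hq : 1 ≤ q) (hN : 1 ≤ N) (he : 1 ≤ e)
    (hs : 1 ≤ s) (hE : 2 ≤ p * e) (hB : p * e + B = N * s) (hEB : Nat.Coprime (p * e) B)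
    (hNB : N ≤ p * e + B) (hes : e * (p + q) = s * (N + c)) {δ : Fin (N + c + 1 + 1) → 𝕜}
    (h : ∀ i : Fin (N + c + 1 + 1), ∑ l, δ l *
      linearizedCoeff p q (N + c) (seed 𝕜 c N) ((i + 1) * e) ((i + 1) * s - 1)
        (vectorField (pertP 𝕜 (N + c) l : MvPowerSeries (Fin 2) 𝕜) (pertQ 𝕜 (N + c) l)
          (firstIntegral p q (N + c) (seed 𝕜 c N))) = 0) : δ = 0 := by
  have hw : (fun l : Fin (N + c + 1 + 1) => δ l * weight 𝕜 p q (N + c) l) = 0 := by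
    refine matEntry_injective (M := fun i => N * (i * s - 1)) hE hEB hNB hN rfl ?_ ?_
    · intro i hi
      have h1 : 1 ≤ i * s := Nat.mul_pos hi hs
      rw [hB]
      zify [h1]
      ring
    · intro i hi hi'
      obtain ⟨j, rfl⟩ : ∃ j, i = j + 1 := ⟨i - 1, by omega⟩
      have h1 : 1 ≤ (j + 1) * s := Nat.mul_pos hi hs
      have h2 := h ⟨j, by omega⟩
      simp only at h2
      rw [← mul_zero ((((N + c : ℕ) : 𝕜)) * (((j + 1) * s - 1 : ℕ) : 𝕜)), ← h2, Finset.mul_sum]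
      refine Finset.sum_congr rfl fun l _ => ?_
      have h3 := linearizedCoeff_variation (𝕜 := 𝕜) (p := p) (q := q) (c := c) (N := N)
        (k := (j + 1) * e) (r := (j + 1) * s - 1) (l := l) (by omega)
        (by rw [Nat.sub_add_cancel h1, mul_assoc, mul_assoc, hes]) (by omega)
      rw [mul_left_comm, h3, matEntry, show (j + 1) * (p * e) = (j + 1) * e * p by ring]
      ring
  have hw' : ∀ l : Fin (N + c + 1 + 1), δ l = 0 ∨
      ((l : ℕ) ≠ 0 ∧ (N + c) * p = (p + q) * l) := by
    intro l
    rcases mul_eq_zero.mp (congrFun hw l) with h1 | h1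
    · exact Or.inl h1
    · right
      rw [weight] at h1
      split_ifs at h1 with hl
      · exfalso
        rw [neg_eq_zero] at h1
        have h2 : (N + c) * p + (p + q) = 0 := by exact_mod_cast h1
        omega
      · exact ⟨hl, by exact_mod_cast sub_eq_zero.mp h1⟩
  by_contra hne
  obtain ⟨l₀, hl₀⟩ := Function.ne_iff.mp hne
  obtain ⟨hl1, hl2⟩ := (hw' l₀).resolve_left hl₀
  -- the weight vanishes at `l₀`, which forces `s = 1`
  have hsl : p * e = s * l₀ := by
    apply Nat.eq_of_mul_eq_mul_left (by omega : 0 < p + q)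
    calc (p + q) * (p * e) = p * (e * (p + q)) := by ring
      _ = s * ((N + c) * p) := by rw [hes]; ring
      _ = (p + q) * (s * l₀) := by rw [hl2]; ring
  have hs1 : s = 1 := by
    refine Nat.eq_one_of_dvd_coprimes hEB ⟨_, hsl⟩ ?_
    rw [← Nat.dvd_add_right (Dvd.intro _ hsl.symm), hB]
    exact Dvd.intro_left _ rfl
  subst hs1
  rw [one_mul] at hsl hes
  have hl3 : (l₀ : ℕ) = e * p := by rw [← hsl, mul_comm]
  have h0 := h 0
  rw [Finset.sum_eq_single l₀] at h0
  · simp only [Fin.val_zero, zero_add, one_mul, Nat.sub_self] at h0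
    rw [hl3, linearizedCoeff_variation_resonant (by omega) hp he hes (isHomogeneous_seed c N)] at h0
    rcases mul_eq_zero.mp h0 with h1 | h1
    · exact hl₀ h1
    · have : q = 0 := by exact_mod_cast h1
      omega
  · intro l _ hl
    rcases hw' l with h1 | ⟨-, h1⟩
    · rw [h1, zero_mul]
    · exact absurd (Fin.ext (Nat.eq_of_mul_eq_mul_left (by omega) (h1.symm.trans hl2))) hl
  · simp

end Assembly

section Main

variable (𝕜 : Type*) [RCLike 𝕜]

/-- The order `(n + 1) e` is attained by a small perturbation of the integrable system, where
`n = N + c + 1`. -/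
lemma exists_saddleOrder {p q c N e s B : ℕ} (hp : 1 ≤ p) (hq : 1 ≤ q) (hpq : Nat.Coprime p q)
    (hN : 1 ≤ N) (he : 1 ≤ e) (hs : 1 ≤ s) (hE : 2 ≤ p * e) (hB : p * e + B = N * s)
    (hEB : Nat.Coprime (p * e) B) (hNB : N ≤ p * e + B) (hes : e * (p + q) = s * (N + c))
    (hcop : Nat.Coprime e s) :
    (N + c + 1 + 1) * e ∈ homogeneousSaddleOrders 𝕜 p q (N + c + 1) := by
  set a := N + c with hadef
  have ha : 1 ≤ a := by omega
  set g := seed 𝕜 c N with hgdef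
  have hg : g.IsHomogeneous a := isHomogeneous_seed c N
  set φ := cofactor p q a g with hφ
  have hφh : φ.IsHomogeneous a := isHomogeneous_cofactor p q ha hg
  set P₀ := MvPolynomial.X 0 * φ with hP₀
  set Q₀ := MvPolynomial.X 1 * φ with hQ₀
  have hX : ∀ i : Fin 2, (MvPolynomial.X i * φ).IsHomogeneous (a + 1) := fun i => by
    have := (MvPolynomial.isHomogeneous_X 𝕜 i).mul hφh
    rwa [add_comm] at this
  set P : (Fin (a + 1 + 1) → 𝕜) → MvPolynomial (Fin 2) 𝕜 := perturbed a P₀ (pertP 𝕜) with hPdef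
  set Q : (Fin (a + 1 + 1) → 𝕜) → MvPolynomial (Fin 2) 𝕜 := perturbed a Q₀ (pertQ 𝕜) with hQdef
  have hP : ∀ v, (P v).IsHomogeneous (a + 1) :=
    isHomogeneous_perturbed (hX 0) fun l hl => isHomogeneous_pertP hl
  have hQ : ∀ v, (Q v).IsHomogeneous (a + 1) :=
    isHomogeneous_perturbed (hX 1) fun l hl => isHomogeneous_pertQ hl
  set I := firstIntegral p q a g with hI
  set R := resonantPart p q I with hR
  have hRgr : GradedSupport (p + q) a R := by
    intro m hm
    rw [coeff_resonantPart] at hm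
    split_ifs at hm
    · exact gradedSupport_firstIntegral p q hg m hm
    · exact absurd rfl hm
  have hR1 : coeff (resExp p q) R = 1 := by
    rw [coeff_resonantPart, resExp_zero, resExp_one, if_pos (mul_comm _ _),
      coeff_resExp_firstIntegral]
  have hRres : ∀ m : Fin 2 →₀ ℕ, p * m 0 ≠ q * m 1 → coeff m R = 0 := fun m hm => by
    rw [coeff_resonantPart, if_neg hm]
  set H : (Fin (a + 1 + 1) → 𝕜) → MvPowerSeries (Fin 2) 𝕜 :=
    fun v => normalForm p q (P v) (Q v) R with hHdef
  have hH0 : H 0 = I := by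
    symm
    rw [hHdef]
    simp only [hPdef, hQdef, perturbed_zero]
    refine eq_normalForm (n := a + 1) (by omega) (hX 0) (hX 1) ?_
    ext m
    have h := congrArg (coeff m) (lieDeriv_firstIntegral p q ha hg)
    rw [map_zero, coeff_lieDeriv] at h
    rw [map_add, coeff_resonantPart, coeff_linInv]
    split_ifs with hm
    · have : (p : 𝕜) * m 0 - q * m 1 = 0 := by
        rw [sub_eq_zero]
        exact_mod_cast hm
      rw [this, div_zero, add_zero]
    · rw [zero_add, eq_div_iff (resonance_ne_zero hm)]
      linear_combination h
  have hPc : ∀ m, ContDiff 𝕜 1 fun v => (P v).coeff m := fun m => by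
    simp only [hPdef, perturbed, MvPolynomial.coeff_add, MvPolynomial.coeff_sum,
      MvPolynomial.coeff_C_mul]
    exact contDiff_const.add (ContDiff.sum fun l _ => (contDiff_apply 𝕜 𝕜 l).mul contDiff_const)
  have hQc : ∀ m, ContDiff 𝕜 1 fun v => (Q v).coeff m := fun m => by
    simp only [hQdef, perturbed, MvPolynomial.coeff_add, MvPolynomial.coeff_sum,
      MvPolynomial.coeff_C_mul]
    exact contDiff_const.add (ContDiff.sum fun l _ => (contDiff_apply 𝕜 𝕜 l).mul contDiff_const)
  have hHc : ∀ m, ContDiff 𝕜 1 fun v => coeff m (H v) :=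
    contDiff_coeff_normalForm p q hPc hQc R
  set τ : Fin (a + 1 + 1) → Fin (a + 1 + 1) → (Fin (a + 1 + 1) → 𝕜) → 𝕜 := fun i l v =>
    linearizedCoeff p q a g ((i + 1) * e) ((i + 1) * s - 1)
      (vectorField (pertP 𝕜 a l : MvPowerSeries (Fin 2) 𝕜) (pertQ 𝕜 a l) (H v)) with hτdef
  have hτc : ∀ i l, ContDiff 𝕜 1 (τ i l) := fun i l =>
    contDiff_coeff_mul_const
      (contDiff_coeff_vectorField (fun _ => contDiff_const) (fun _ => contDiff_const) hHc) _ _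
  have hinj : ∀ δ : Fin (a + 1 + 1) → 𝕜, (∀ i, ∑ l, δ l * τ i l 0 = 0) → δ = 0 := by
    intro δ hδ
    simp only [hτdef, hH0] at hδ
    exact variation_injective hp hq hN he hs hE hB hEB hNB hes hδ
  obtain ⟨v, ε, hε, hv⟩ := exists_mulVec_eq_single hτc hinj (Fin.last _)
  set Z := lieDeriv p q (P v) (Q v) (H v) with hZ
  have hZτ : ∀ i : Fin (a + 1 + 1), linearizedCoeff p q a g ((i + 1) * e) ((i + 1) * s - 1) Z =
      (Pi.single (Fin.last _) ε : Fin (a + 1 + 1) → 𝕜) i := by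
    intro i
    have h1 : 1 ≤ ((i : ℕ) + 1) * s := Nat.mul_pos (Nat.succ_pos _) hs
    rw [hZ, hPdef, hQdef, lieDeriv_perturbed, linearizedCoeff_add_sum,
      linearizedCoeff_lieDeriv ha (by rw [Nat.sub_add_cancel h1, mul_assoc, mul_assoc, hes]) hg,
      zero_add]
    exact hv i
  have hexp := isSaddleExpansion_normalForm ha hp hpq (hP v) (hQ v) hRgr hR1 hRres
  have hZgr : GradedSupport (p + q) a Z := by
    have hgr : GradedSupport (p + q) a (H v) := hRgr.normalForm (hP v) (hQ v)
    intro m hm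
    rw [hZ, coeff_lieDeriv] at hm
    by_cases h0 : coeff m (H v) = 0
    · rw [h0, mul_zero, zero_add] at hm
      exact (hgr.vectorField (hP v) (hQ v)).of_add m hm
    · exact hgr m h0
  -- below the degree of the first nonzero saddle value, the derivative vanishes
  have hlow : ∀ k, (∀ j, 1 ≤ j → j < k → coeff ((j + 1) • resExp p q) Z = 0) →
      ∀ m : Fin 2 →₀ ℕ, m.degree < (k + 1) * (p + q) → coeff m Z = 0 := by
    intro k hk m hm
    by_cases hm' : ∃ j, 1 ≤ j ∧ m = (j + 1) • resExp p q
    · obtain ⟨j, hj, rfl⟩ := hm'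
      rw [map_nsmul, degree_resExp, smul_eq_mul] at hm
      have := Nat.lt_of_mul_lt_mul_right hm
      exact hk j hj (by omega)
    · push Not at hm'
      exact hexp.coeff_other m hm'
  have hzero : ∀ k, 1 ≤ k → k < (a + 1 + 1) * e → coeff ((k + 1) • resExp p q) Z = 0 := by
    intro k
    induction k using Nat.strong_induction_on with
    | _ k ih =>
      intro hk hk'
      by_contra hne
      have hdvd : e ∣ k := by
        obtain ⟨t, ht⟩ := hZgr _ hne
        rw [map_nsmul, degree_resExp, smul_eq_mul] at ht
        have h1 : k * (p + q) = t * a := by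
          rw [add_mul] at ht
          omega
        refine hcop.dvd_of_dvd_mul_right ⟨t, ?_⟩
        apply Nat.eq_of_mul_eq_mul_right ha
        calc k * s * a = k * (s * a) := by ring
          _ = e * (k * (p + q)) := by rw [← hes]; ring
          _ = e * t * a := by rw [h1]; ring
      obtain ⟨j, rfl⟩ := hdvd
      have hj : 1 ≤ j := Nat.pos_of_mul_pos_left hk
      have hj' : j < a + 1 + 1 := by
        rw [mul_comm] at hk'
        exact Nat.lt_of_mul_lt_mul_right hk'
      have h1 := hZτ ⟨j - 1, by omega⟩
      simp only [Nat.sub_add_cancel hj, mul_comm j e] at h1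
      rw [linearizedCoeff_of_low ha hg
        (hlow _ fun i hi hi' => ih i hi' hi (hi'.trans hk'))] at h1
      apply hne
      rw [h1, Pi.single_eq_of_ne]
      intro h2
      have := congrArg Fin.val h2
      simp at this
      omega
  refine ⟨P v, Q v, hP v, hQ v, H v, _, hexp, Nat.mul_pos (Nat.succ_pos _) he, hzero, ?_⟩
  have h1 := hZτ (Fin.last _)
  rw [Pi.single_eq_same, Fin.val_last, linearizedCoeff_of_low ha hg (hlow _ hzero)] at h1
  exact fun h2 => hε (h1.symm.trans h2)

lemma le_maxSaddleOrder {p q n : ℕ} (hp : 1 ≤ p) (hq : 1 ≤ q) (hpq : Nat.Coprime p q)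
    (hn : (p + 1) * (p + q) + 2 ≤ n) :
    (((n ^ 2 - 1) / Nat.gcd (n - 1) (p + q) : ℕ) : ℕ∞) ≤ maxSaddleOrder 𝕜 p q n := by
  obtain ⟨a, rfl⟩ : ∃ a, n = a + 1 := ⟨n - 1, by omega⟩
  obtain ⟨c, N, e, s, B, rfl, hN, he, hs, hE, hB, hEB, hNB, hes, hcop, hd⟩ :=
    exists_parameters hp hq hpq (a := a) (by omega)
  have h := exists_saddleOrder 𝕜 hp hq hpq hN he hs hE hB hEB hNB hes hcop
  have hval : ((N + c + 1) ^ 2 - 1) / Nat.gcd (N + c + 1 - 1) (p + q) = (N + c + 1 + 1) * e := by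
    rw [Nat.add_sub_cancel]
    refine Nat.div_eq_of_eq_mul_right (Nat.gcd_pos_of_pos_right _ (by omega)) ?_
    rw [mul_left_comm, ← hd, Nat.sub_eq_iff_eq_add (Nat.one_le_pow _ _ (by omega))]
    ring
  rw [hval, maxSaddleOrder]
  exact le_iSup₂ (f := fun (k : ℕ) (_ : k ∈ homogeneousSaddleOrders 𝕜 p q (N + c + 1)) => (k : ℕ∞))
    _ h

end Main

end ResonantSaddle

end

theorem theorem1 (p q : ℕ) (hp : 1 ≤ p) (hq : 1 ≤ q) (hpq : Nat.Coprime p q) :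
    ∃ N : ℕ, ∀ n : ℕ, N ≤ n →
      (((n ^ 2 - 1) / Nat.gcd (n - 1) (p + q) : ℕ) : ℕ∞) ≤
          ResonantSaddle.maxSaddleOrder ℝ p q n ∧
      (((n ^ 2 - 1) / Nat.gcd (n - 1) (p + q) : ℕ) : ℕ∞) ≤
          ResonantSaddle.maxSaddleOrder ℂ p q n :=
  ⟨(p + 1) * (p + q) + 2, fun _ hn => ⟨ResonantSaddle.le_maxSaddleOrder ℝ hp hq hpq hn,
    ResonantSaddle.le_maxSaddleOrder ℂ hp hq hpq hn⟩⟩
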